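/- Let $B$ be a (not necessarily commutative) ring with $1$, let $\rho$ be an automorphism of $B$ of finite order $m\ge 1$, and let $B[X;\rho]$ be the skew polynomial ring with multiplication $\alpha X = X\rho(\alpha)$ $(\alpha\in B)$. Let $$f = X^m + X^{m-1}a_{m-1}+\cdots+Xa_1+a_0=\sum_{j=0}^m X^ja_j\qquad(a_m=1)$$ be a monic polynomial, of degree equal to the order $m$ of $\rho$, such that $fB[X;\rho]=B[X;\rho]f$ and $\rho(a_j)=a_j$ for all $j$. Put $A = B[X;\rho]/fB[X;\rho]$ and $x = X+fB[X;\rho]\in A$. Let $C(A)$ be the center of $A$, $V=\{h\in A \mid \alpha h=h\alpha \text{ for all } \alpha\in B\}$, and $J_\rho=\{h\in A\mid \alpha h=h\rho(\alpha)\text{ for all }\alpha\in B\}$. Let $\tilde\rho$ be the automorphism of $A$ induced by $\rho$, $\tilde\rho\big(\sum_{j} x^jc_j\big)=\sum_{j} x^j\rho(c_j)$, and put $V^{\tilde\rho}=\{h\in V\mid\tilde\rho(h)=h\}$. Let $I_x(h)=hx-xh$ and $\tau(h)=\sum_{k=0}^{m-1}x^k\sum_{j=0}^{k}\tilde\rho^{\,j}(h)\,a_{k+1}$.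 Call $A/B$ separable if the $A$-$A$-homomorphism $A\otimes_BA\to A$, $a\otimes b\mapsto ab$, splits, and weakly separable if every $B$-derivation of $A$ to $A$ (an additive map $\delta: A\to A$ with $\delta(yz)=\delta(y)z+y\delta(z)$ for $y,z\in A$ and $\delta(\alpha)=0$ for $\alpha\in B$) is inner, i.e. of the form $w\mapsto cw-wc$ for some $c\in A$; $f$ is called separable (resp. weakly separable) in $B[X;\rho]$ if $A/B$ is. Then the inclusion $C(A)\to V$, $I_x: V\to J_\rho$ and $\tau: J_\rho\to V^{\tilde\rho}$ are well-defined $V^{\tilde\rho}$-$V^{\tilde\rho}$-homomorphisms, and: (1) $f$ is weakly separable in $B[X;\rho]$ if and only if the sequence $$0\longrightarrow C(A)\overset{\rm inj}{\longrightarrow}V\overset{I_x}{\longrightarrow}J_\rho\overset{\tau}{\longrightarrow}V^{\tilde\rho}$$ is exact. (2) $f$ is separable in $B[X;\rho]$ if and only if the sequence $$0\longrightarrow C(A)\overset{\rm inj}{\longrightarrow}V\overset{I_x}{\longrightarrow}J_\rho\overset{\tau}{\longrightarrow}V^{\tilde\rho}\longrightarrow 0$$ is exact. -/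

import Mathlib

open scoped TensorProduct

noncomputable section

namespace SkewSep

/-! ### Ring extensions: separability and weak separability

A ring extension `A/B` is given by its structure map `φ : B →+* A`; neither ring is assumed
commutative. -/

section Extension

variable {A B : Type*} [Ring A] [Ring B]

/-- The additive subgroup of `A ⊗_ℤ A` generated by the elements `aβ ⊗ c - a ⊗ βc`, `β ∈ B`. -/
def balancing (φ : B →+* A) : AddSubgroup (A ⊗[ℤ] A) :=
  AddSubgroup.closure {t | ∃ (a : A) (β : B) (c : A), t = (a * φ β) ⊗ₜ[ℤ] c - a ⊗ₜ[ℤ] (φ β * c)}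

/-- The tensor product `A ⊗_B A` over the (noncommutative) ring `B`. -/
abbrev RelTensor (φ : B →+* A) : Type _ := (A ⊗[ℤ] A) ⧸ balancing φ

theorem balancing_le_comap_left (φ : B →+* A) (a : A) :
    balancing φ ≤ (balancing φ).comap
      (TensorProduct.map (LinearMap.mulLeft ℤ a) LinearMap.id).toAddMonoidHom := by
  refine (AddSubgroup.closure_le _).2 ?_
  rintro _ ⟨x, β, c, rfl⟩
  refine AddSubgroup.subset_closure ⟨a * x, β, c, ?_⟩
  simp [mul_assoc]

theorem balancing_le_comap_right (φ : B →+* A) (a : A) :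
    balancing φ ≤ (balancing φ).comap
      (TensorProduct.map LinearMap.id (LinearMap.mulRight ℤ a)).toAddMonoidHom := by
  refine (AddSubgroup.closure_le _).2 ?_
  rintro _ ⟨x, β, c, rfl⟩
  refine AddSubgroup.subset_closure ⟨x, β, c * a, ?_⟩
  simp [mul_assoc]

theorem balancing_le_ker_mul (φ : B →+* A) :
    balancing φ ≤ (LinearMap.mul' ℤ A).toAddMonoidHom.ker := by
  refine (AddSubgroup.closure_le _).2 ?_
  rintro _ ⟨x, β, c, rfl⟩
  simp [AddMonoidHom.mem_ker, mul_assoc]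

/-- Left multiplication by `a` on `A ⊗_B A`: `a (x ⊗ y) = (a x) ⊗ y`. -/
def RelTensor.lmul (φ : B →+* A) (a : A) : RelTensor φ →+ RelTensor φ :=
  QuotientAddGroup.map _ _ _ (balancing_le_comap_left φ a)

/-- Right multiplication by `a` on `A ⊗_B A`: `(x ⊗ y) a = x ⊗ (y a)`. -/
def RelTensor.rmul (φ : B →+* A) (a : A) : RelTensor φ →+ RelTensor φ :=
  QuotientAddGroup.map _ _ _ (balancing_le_comap_right φ a)

/-- The multiplication map `A ⊗_B A → A`, `x ⊗ y ↦ x y`. -/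
def RelTensor.mul (φ : B →+* A) : RelTensor φ →+ A :=
  QuotientAddGroup.lift _ _ (balancing_le_ker_mul φ)

/-- `A/B` is separable: the multiplication map `A ⊗_B A → A` splits as a homomorphism of
`A`-`A`-bimodules. -/
def IsSeparableExtension (φ : B →+* A) : Prop :=
  ∃ s : A →+ RelTensor φ,
    (∀ a x : A, s (a * x) = RelTensor.lmul φ a (s x)) ∧
    (∀ a x : A, s (x * a) = RelTensor.rmul φ a (s x)) ∧
    ∀ x : A, RelTensor.mul φ (s x) = x

/-- `δ` is a `B`-derivation of `A` to `A`. -/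
def IsRelDerivation (φ : B →+* A) (δ : A →+ A) : Prop :=
  (∀ x y : A, δ (x * y) = δ x * y + x * δ y) ∧ ∀ β : B, δ (φ β) = 0

/-- `A/B` is weakly separable: every `B`-derivation of `A` to `A` is inner. -/
def IsWeaklySeparableExtension (φ : B →+* A) : Prop :=
  ∀ δ : A →+ A, IsRelDerivation φ δ → ∃ c : A, ∀ x : A, δ x = c * x - x * c

end Extension

/-! ### Bimodules inside a ring -/

section Bimodule

variable {A : Type*} [Ring A]

/-- `M` is an `S`-`S`-subbimodule of `A`. -/
def IsSubbimodule (S : Subring A) (M : AddSubgroup A) : Prop :=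
  ∀ s ∈ S, ∀ h ∈ M, s * h ∈ M ∧ h * s ∈ M

/-- `M` and `N` are `S`-`S`-subbimodules of `A`, and `g : M → N` is an `S`-`S`-homomorphism. -/
structure IsBimoduleHom (S : Subring A) {M N : AddSubgroup A} (g : M →+ N) : Prop where
  source : IsSubbimodule S M
  target : IsSubbimodule S N
  map_left : ∀ s ∈ S, ∀ h h' : M, (h' : A) = s * h → (g h' : A) = s * g h
  map_right : ∀ s ∈ S, ∀ h h' : M, (h' : A) = h * s → (g h' : A) = g h * s

end Bimodule

/-! ### The skew polynomial ring `B[X;ρ]`, with `α X = X ρ(α)` -/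

section SkewPoly

variable {B : Type*} [Ring B]

/-- The action of `ℕ` on `B` for which `1` acts as `ρ⁻¹`. -/
@[reducible]
def twist (ρ : RingAut B) : MulSemiringAction (Multiplicative ℕ) B :=
  MulSemiringAction.compHom B (powersHom (RingAut B) ρ⁻¹)

/-- The skew polynomial ring `B[X;ρ]`. Mathlib's skew polynomials satisfy `X α = φ(α) X`; here
`φ = ρ⁻¹`, which is the rule `α X = X ρ(α)`. -/
def SkewPoly (_ρ : RingAut B) : Type _ := SkewPolynomial B

variable (ρ : RingAut B)

instance : Ring (SkewPoly ρ) :=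
  letI := twist ρ
  inferInstanceAs (Ring (SkewMonoidAlgebra B (Multiplicative ℕ)))

/-- The inclusion `B → B[X;ρ]`. -/
def SkewPoly.C : B →+* SkewPoly ρ :=
  letI := twist ρ
  (SkewPolynomial.CRingHom : B →+* SkewPolynomial B)

/-- The indeterminate. -/
def SkewPoly.X : SkewPoly ρ := (SkewPolynomial.X : SkewPolynomial B)

theorem SkewPoly.C_mul_X (α : B) :
    SkewPoly.C ρ α * SkewPoly.X ρ = SkewPoly.X ρ * SkewPoly.C ρ (ρ α) := by
  let := twist ρ
  have h : (SkewMonoidAlgebra.single 1 α * SkewMonoidAlgebra.single (Multiplicative.ofAdd 1) 1 :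
      SkewMonoidAlgebra B (Multiplicative ℕ)) =
      SkewMonoidAlgebra.single (Multiplicative.ofAdd 1) 1 * SkewMonoidAlgebra.single 1 (ρ α) := by
    rw [SkewMonoidAlgebra.single_mul_single, SkewMonoidAlgebra.single_mul_single, one_mul, mul_one,
      smul_one, mul_one, one_mul]
    congr 1
    exact (ρ.symm_apply_apply α).symm
  exact h

/-- The ring homomorphism from `B[X;ρ]` determined by its values on `B` and at `X`. -/
def SkewPoly.lift {R : Type*} [Ring R] (g : B →+* R) (y : R)
    (hy : ∀ α : B, g α * y = y * g (ρ α)) : SkewPoly ρ →+* R :=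
  letI := twist ρ
  (SkewMonoidAlgebra.liftNCRingHom g (powersHom R y) (by
    intro α n
    have key : ∀ (k : ℕ) (α : B), g α * y ^ k = y ^ k * g ((ρ ^ k) α) := by
      intro k
      induction k with
      | zero => simp
      | succ k ih =>
        intro α
        rw [pow_succ, ← mul_assoc, ih, mul_assoc, hy, ← mul_assoc, pow_succ' ρ]
        rfl
    have h : (ρ ^ n.toAdd) (n • α) = α := by
      change (ρ ^ n.toAdd * (ρ⁻¹) ^ n.toAdd) α = α
      simp
    change g (n • α) * y ^ n.toAdd = y ^ n.toAdd * g α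
    rw [key, h]) : SkewMonoidAlgebra B (Multiplicative ℕ) →+* R)

theorem SkewPoly.lift_C {R : Type*} [Ring R] (g : B →+* R) (y : R)
    (hy : ∀ α : B, g α * y = y * g (ρ α)) (α : B) :
    SkewPoly.lift ρ g y hy (SkewPoly.C ρ α) = g α := by
  let := twist ρ
  change SkewMonoidAlgebra.liftNC (g : B →+ R) (powersHom R y)
    (SkewMonoidAlgebra.single 1 α) = g α
  rw [SkewMonoidAlgebra.liftNC_single]
  simp

theorem SkewPoly.lift_X {R : Type*} [Ring R] (g : B →+* R) (y : R)
    (hy : ∀ α : B, g α * y = y * g (ρ α)) :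
    SkewPoly.lift ρ g y hy (SkewPoly.X ρ) = y := by
  let := twist ρ
  change SkewMonoidAlgebra.liftNC (g : B →+ R) (powersHom R y)
    (SkewMonoidAlgebra.single (Multiplicative.ofAdd 1) 1) = y
  rw [SkewMonoidAlgebra.liftNC_single]
  simp

theorem SkewPoly.hom_ext {R : Type*} [Ring R] {u v : SkewPoly ρ →+* R}
    (hC : ∀ α, u (SkewPoly.C ρ α) = v (SkewPoly.C ρ α))
    (hX : u (SkewPoly.X ρ) = v (SkewPoly.X ρ)) : u = v := by
  let := twist ρ
  have h : (u : SkewPoly ρ →+ R) = v := by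
    refine SkewMonoidAlgebra.addHom_ext (k := B) (G := Multiplicative ℕ) fun n b => ?_
    have e : (SkewMonoidAlgebra.single n b : SkewMonoidAlgebra B (Multiplicative ℕ)) =
        (SkewPoly.C ρ b * SkewPoly.X ρ ^ n.toAdd : SkewPoly ρ) :=
      (SkewPolynomial.C_mul_X_pow_eq_monomial (a := b) (n := n.toAdd)).symm
    change u _ = v _
    rw [e]
    simp [hC, hX]
  exact RingHom.ext fun p => DFunLike.congr_fun h p

/-- For `σ` commuting with `ρ`, the endomorphism `∑ Xʲ cⱼ ↦ ∑ Xʲ σ(cⱼ)` of `B[X;ρ]`. -/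
def SkewPoly.mapCoeffs (σ : RingAut B) (hσ : ∀ α, σ (ρ α) = ρ (σ α)) : SkewPoly ρ →+* SkewPoly ρ :=
  SkewPoly.lift ρ ((SkewPoly.C ρ).comp (σ : B →+* B)) (SkewPoly.X ρ) fun α => by
    simpa [hσ] using SkewPoly.C_mul_X ρ (σ α)

theorem SkewPoly.mapCoeffs_C (σ : RingAut B) (hσ : ∀ α, σ (ρ α) = ρ (σ α)) (α : B) :
    SkewPoly.mapCoeffs ρ σ hσ (SkewPoly.C ρ α) = SkewPoly.C ρ (σ α) := by
  unfold SkewPoly.mapCoeffs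
  rw [SkewPoly.lift_C]
  rfl

theorem SkewPoly.mapCoeffs_X (σ : RingAut B) (hσ : ∀ α, σ (ρ α) = ρ (σ α)) :
    SkewPoly.mapCoeffs ρ σ hσ (SkewPoly.X ρ) = SkewPoly.X ρ := by
  unfold SkewPoly.mapCoeffs
  rw [SkewPoly.lift_X]

/-- The automorphism `∑ Xʲ cⱼ ↦ ∑ Xʲ ρ(cⱼ)` of `B[X;ρ]`. -/
def SkewPoly.coeffAut : SkewPoly ρ ≃+* SkewPoly ρ :=
  RingEquiv.ofRingHom
    (SkewPoly.mapCoeffs ρ ρ fun _ => rfl)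
    (SkewPoly.mapCoeffs ρ ρ.symm fun α => (ρ.symm_apply_apply α).trans (ρ.apply_symm_apply α).symm)
    (SkewPoly.hom_ext ρ
      (fun α => by
        simp only [RingHom.comp_apply, SkewPoly.mapCoeffs_C, RingEquiv.apply_symm_apply,
          RingHom.id_apply])
      (by simp only [RingHom.comp_apply, SkewPoly.mapCoeffs_X, RingHom.id_apply]))
    (SkewPoly.hom_ext ρ
      (fun α => by
        simp only [RingHom.comp_apply, SkewPoly.mapCoeffs_C, RingEquiv.symm_apply_apply,
          RingHom.id_apply])
      (by simp only [RingHom.comp_apply, SkewPoly.mapCoeffs_X, RingHom.id_apply]))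

theorem SkewPoly.coeffAut_C (α : B) :
    SkewPoly.coeffAut ρ (SkewPoly.C ρ α) = SkewPoly.C ρ (ρ α) :=
  SkewPoly.mapCoeffs_C ρ ρ (fun _ => rfl) α

theorem SkewPoly.coeffAut_X : SkewPoly.coeffAut ρ (SkewPoly.X ρ) = SkewPoly.X ρ :=
  SkewPoly.mapCoeffs_X ρ ρ (fun _ => rfl)

/-- The polynomial `∑_{j ≤ m} Xʲ aⱼ`. -/
def SkewPoly.ofCoeffs (m : ℕ) (a : ℕ → B) : SkewPoly ρ :=
  ∑ j ∈ Finset.range (m + 1), SkewPoly.X ρ ^ j * SkewPoly.C ρ (a j)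

theorem SkewPoly.coeffAut_ofCoeffs {m : ℕ} {a : ℕ → B} (ha : ∀ j ≤ m, ρ (a j) = a j) :
    SkewPoly.coeffAut ρ (SkewPoly.ofCoeffs ρ m a) = SkewPoly.ofCoeffs ρ m a := by
  unfold SkewPoly.ofCoeffs
  rw [map_sum]
  refine Finset.sum_congr rfl fun j hj => ?_
  rw [map_mul, map_pow, SkewPoly.coeffAut_X, SkewPoly.coeffAut_C,
    ha j (Nat.lt_succ_iff.1 (Finset.mem_range.1 hj))]

/-- `f B[X;ρ] = B[X;ρ] f`. A monic `f` with this property is a member of `B[X;ρ]_{(0)}`. -/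
def SkewPoly.IsInvariant {ρ : RingAut B} (f : SkewPoly ρ) : Prop :=
  {p : SkewPoly ρ | ∃ g, p = f * g} = {p : SkewPoly ρ | ∃ g, p = g * f}

/-- The two-sided ideal generated by `f`; it is `f B[X;ρ]` when `f` is invariant. -/
def SkewPoly.ideal {ρ : RingAut B} (f : SkewPoly ρ) : Ideal (SkewPoly ρ) :=
  (TwoSidedIdeal.span {f}).asIdeal

instance {ρ : RingAut B} (f : SkewPoly ρ) : (SkewPoly.ideal f).IsTwoSided :=
  inferInstanceAs (TwoSidedIdeal.span {f}).asIdeal.IsTwoSided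

theorem SkewPoly.mem_ideal_iff {ρ : RingAut B} {f : SkewPoly ρ} (hf : f.IsInvariant)
    (p : SkewPoly ρ) : p ∈ SkewPoly.ideal f ↔ ∃ g, p = f * g := by
  constructor
  · intro hp
    let I : TwoSidedIdeal (SkewPoly ρ) := TwoSidedIdeal.mk' {p | ∃ g, p = f * g}
      ⟨0, by simp⟩
      (by rintro _ _ ⟨g, rfl⟩ ⟨h, rfl⟩; exact ⟨g + h, (mul_add ..).symm⟩)
      (by rintro _ ⟨g, rfl⟩; exact ⟨-g, (mul_neg ..).symm⟩)
      (by
        intro x y hy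
        rw [hf] at hy ⊢
        obtain ⟨g, rfl⟩ := hy
        exact ⟨x * g, (mul_assoc ..).symm⟩)
      (by rintro _ y ⟨g, rfl⟩; exact ⟨g * y, mul_assoc ..⟩)
    have hI : TwoSidedIdeal.span {f} ≤ I := by
      rw [TwoSidedIdeal.span_le, Set.singleton_subset_iff]
      exact (TwoSidedIdeal.mem_mk' ..).2 ⟨1, (mul_one f).symm⟩
    have hp' : p ∈ I := hI (TwoSidedIdeal.mem_asIdeal.1 hp)
    rw [TwoSidedIdeal.mem_mk'] at hp'
    exact hp'
  · rintro ⟨g, rfl⟩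
    exact (SkewPoly.ideal f).mul_mem_right g
      (TwoSidedIdeal.mem_asIdeal.2 (TwoSidedIdeal.subset_span rfl))

end SkewPoly

/-! ### The residue ring `A = B[X;ρ]/f B[X;ρ]` -/

section Residue

variable {B : Type*} [Ring B] {ρ : RingAut B}

/-- `A = B[X;ρ]/f B[X;ρ]`. -/
abbrev Residue (f : SkewPoly ρ) : Type _ := SkewPoly ρ ⧸ SkewPoly.ideal f

/-- The structure map `B → A`. -/
def Residue.coe (f : SkewPoly ρ) : B →+* Residue f :=
  (Ideal.Quotient.mk (SkewPoly.ideal f)).comp (SkewPoly.C ρ)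

/-- The residue class `x` of `X`. -/
def Residue.x (f : SkewPoly ρ) : Residue f :=
  Ideal.Quotient.mk (SkewPoly.ideal f) (SkewPoly.X ρ)

theorem SkewPoly.ideal_eq_map (f : SkewPoly ρ) (e : SkewPoly ρ ≃+* SkewPoly ρ) (he : e f = f) :
    SkewPoly.ideal f = (SkewPoly.ideal f).map (e : SkewPoly ρ →+* SkewPoly ρ) := by
  have key : ∀ e : SkewPoly ρ ≃+* SkewPoly ρ, e f = f →
      ∀ p ∈ SkewPoly.ideal f, e p ∈ SkewPoly.ideal f := by
    intro e he p hp
    have hI : TwoSidedIdeal.span {f} ≤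
        (TwoSidedIdeal.span {f}).comap (e : SkewPoly ρ →+* SkewPoly ρ) := by
      rw [TwoSidedIdeal.span_le, Set.singleton_subset_iff]
      refine (TwoSidedIdeal.mem_comap _).2 ?_
      change e f ∈ TwoSidedIdeal.span {f}
      rw [he]
      exact TwoSidedIdeal.subset_span rfl
    exact TwoSidedIdeal.mem_asIdeal.2
      ((TwoSidedIdeal.mem_comap _).1 (hI (TwoSidedIdeal.mem_asIdeal.1 hp)))
  apply le_antisymm
  · intro p hp
    have h := key e.symm (e.symm_apply_eq.2 he.symm) p hp
    have h' := Ideal.mem_map_of_mem (e : SkewPoly ρ →+* SkewPoly ρ) h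
    simpa using h'
  · rw [Ideal.map_le_iff_le_comap]
    exact fun p hp => key e he p hp

/-- For `f ∈ B^ρ[X]`, the automorphism `ρ̃` of `A` induced by `ρ`:
`ρ̃ (∑ xʲ cⱼ) = ∑ xʲ ρ(cⱼ)`. -/
def Residue.autTilde {m : ℕ} {a : ℕ → B} (ha : ∀ j ≤ m, ρ (a j) = a j) :
    Residue (SkewPoly.ofCoeffs ρ m a) ≃+* Residue (SkewPoly.ofCoeffs ρ m a) :=
  Ideal.quotientEquiv _ _ (SkewPoly.coeffAut ρ)
    (SkewPoly.ideal_eq_map _ _ (SkewPoly.coeffAut_ofCoeffs ρ ha))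

theorem Residue.autTilde_sum {m : ℕ} {a : ℕ → B} (ha : ∀ j ≤ m, ρ (a j) = a j)
    (n : ℕ) (c : ℕ → B) :
    Residue.autTilde ha (∑ j ∈ Finset.range n, Residue.x _ ^ j * Residue.coe _ (c j)) =
      ∑ j ∈ Finset.range n, Residue.x _ ^ j * Residue.coe _ (ρ (c j)) := by
  have hx : Residue.autTilde ha (Residue.x _) = Residue.x _ :=
    congrArg (Ideal.Quotient.mk _) (SkewPoly.coeffAut_X ρ)
  have hc : ∀ α, Residue.autTilde ha (Residue.coe _ α) = Residue.coe _ (ρ α) := fun α =>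
    congrArg (Ideal.Quotient.mk _) (SkewPoly.coeffAut_C ρ α)
  simp [hx, hc]

/-- `V = V_A(B)`, the centralizer of `B` in `A`. -/
def Residue.V (f : SkewPoly ρ) : Subring (Residue f) :=
  Subring.centralizer (Set.range (Residue.coe f))

/-- `J_ρ = {h ∈ A | α h = h ρ(α) for all α ∈ B}`. -/
def Residue.J (f : SkewPoly ρ) : AddSubgroup (Residue f) where
  carrier := {h | ∀ α : B, Residue.coe f α * h = h * Residue.coe f (ρ α)}
  zero_mem' := by simp
  add_mem' := by
    intro h k hh hk α
    rw [mul_add, add_mul, hh α, hk α]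
  neg_mem' := by
    intro h hh α
    rw [mul_neg, neg_mul, hh α]

/-- `V^ρ̃ = {h ∈ V | ρ̃(h) = h}`. -/
def Residue.fixedV {m : ℕ} {a : ℕ → B} (ha : ∀ j ≤ m, ρ (a j) = a j) :
    Subring (Residue (SkewPoly.ofCoeffs ρ m a)) :=
  Residue.V _ ⊓ RingHom.eqLocus
    (Residue.autTilde ha : _ →+* Residue (SkewPoly.ofCoeffs ρ m a)) (RingHom.id _)

/-- The inner derivation `I_x(h) = h x - x h` of `A`. -/
def Residue.innerX (f : SkewPoly ρ) (h : Residue f) : Residue f :=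
  h * Residue.x f - Residue.x f * h

/-- `τ(h) = ∑_{k=0}^{m-1} xᵏ ∑_{j=0}^{k} ρ̃ʲ(h) a_{k+1}`. -/
def Residue.tau {m : ℕ} {a : ℕ → B} (ha : ∀ j ≤ m, ρ (a j) = a j)
    (h : Residue (SkewPoly.ofCoeffs ρ m a)) : Residue (SkewPoly.ofCoeffs ρ m a) :=
  ∑ k ∈ Finset.range m, Residue.x _ ^ k *
    ∑ j ∈ Finset.range (k + 1), (Residue.autTilde ha)^[j] h * Residue.coe _ (a (k + 1))

end Residue

end SkewSep

end

open SkewSep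

open scoped TensorProduct

/-! Since `B` and `x` generate `A`, a `B`-derivation `δ` is determined by `h = δ(x)`. Applying `δ`
to `αx = xρ(α)` gives `h ∈ J_ρ`; applying it to `f(x) = 0`, and moving each `x` to the left by `hx =
xρ̃(h)`, gives `τ(h) = 0`. Conversely every such `h` occurs (`Residue.exists_isRelDerivation`).
Derivations are therefore `ker τ`, inner ones are `I_x(V)`, and weak separability is exactness at
`J_ρ`. Exactness at the earlier places is automatic, because commuting with `B` and `x` means being
central.

Elements of `V^ρ̃` are central and `τ` is linear over them, so `τ` is surjective iff `τ(h) = 1` for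
some `h ∈ J_ρ`. Put `yⱼ = ∑ₗ xˡ a_{j+l+1}`; then `∑ xʲ h yⱼ = τ(h)`. If `τ(h) = 1`, the element `∑
xʲh ⊗ yⱼ` is a separability idempotent (`Residue.isSeparable_of_tau_eq_one`). Conversely, let `π` be
the functional reading the coefficient of `x^{m-1}`. It satisfies `π(yβ) = π(y)β`, `π(ρ(α)y) =
απ(y)` and `y = ∑ xʲ π(yⱼy)`. For a separability idempotent `e = ∑ e' ⊗ e''`, the element `h = ∑
π(e')e''` lies in `J_ρ` and has `τ(h) = 1` (`Residue.exists_tau_eq_one_of_isSeparable`).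

The equality of degree and order enters through `ρ^m = 1`, which turns the invariance of `f` into
`ρʲ(α)aⱼ = aⱼα` (`SkewPoly.IsInvariant.coeff_mul`). -/

namespace SkewSep

/-! ### Relative tensor products and separability idempotents -/

section Extension

variable {A B : Type*} [Ring A] [Ring B] (φ : B →+* A)

/-- The class of the pure tensor `a ⊗ c` in `A ⊗_B A`. -/
def RelTensor.tmul (a c : A) : RelTensor φ := QuotientAddGroup.mk (a ⊗ₜ[ℤ] c)

theorem RelTensor.tmul_add (a c d : A) :
    RelTensor.tmul φ a (c + d) = RelTensor.tmul φ a c + RelTensor.tmul φ a d :=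
  congrArg QuotientAddGroup.mk (TensorProduct.tmul_add a c d)

theorem RelTensor.add_tmul (a b c : A) :
    RelTensor.tmul φ (a + b) c = RelTensor.tmul φ a c + RelTensor.tmul φ b c :=
  congrArg QuotientAddGroup.mk (TensorProduct.add_tmul a b c)

/-- `RelTensor.tmul` as a biadditive map. -/
def RelTensor.tmulHom : A →+ A →+ RelTensor φ :=
  AddMonoidHom.mk' (fun a => AddMonoidHom.mk' (RelTensor.tmul φ a) (RelTensor.tmul_add φ a))
    fun a b => AddMonoidHom.ext fun c => RelTensor.add_tmul φ a b c

theorem RelTensor.zero_tmul (a : A) : RelTensor.tmul φ 0 a = 0 :=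
  DFunLike.congr_fun (map_zero (RelTensor.tmulHom φ)) a

theorem RelTensor.tmul_sum {ι : Type*} (s : Finset ι) (a : A) (g : ι → A) :
    RelTensor.tmul φ a (∑ i ∈ s, g i) = ∑ i ∈ s, RelTensor.tmul φ a (g i) :=
  map_sum (RelTensor.tmulHom φ a) g s

theorem RelTensor.sum_tmul {ι : Type*} (s : Finset ι) (a : A) (g : ι → A) :
    RelTensor.tmul φ (∑ i ∈ s, g i) a = ∑ i ∈ s, RelTensor.tmul φ (g i) a :=
  map_sum ((RelTensor.tmulHom φ).flip a) g s

theorem RelTensor.mul_tmul (a : A) (β : B) (c : A) :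
    RelTensor.tmul φ (a * φ β) c = RelTensor.tmul φ a (φ β * c) := by
  refine (QuotientAddGroup.eq_iff_sub_mem).2 ?_
  exact AddSubgroup.subset_closure ⟨a, β, c, rfl⟩

theorem RelTensor.lmul_tmul (a x y : A) :
    RelTensor.lmul φ a (RelTensor.tmul φ x y) = RelTensor.tmul φ (a * x) y := rfl

theorem RelTensor.rmul_tmul (a x y : A) :
    RelTensor.rmul φ a (RelTensor.tmul φ x y) = RelTensor.tmul φ x (y * a) := rfl

theorem RelTensor.mul_apply_tmul (x y : A) :
    RelTensor.mul φ (RelTensor.tmul φ x y) = x * y := rfl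

theorem RelTensor.induction {p : RelTensor φ → Prop}
    (tmul : ∀ a c, p (RelTensor.tmul φ a c)) (add : ∀ s t, p s → p t → p (s + t))
    (t : RelTensor φ) : p t := by
  induction t using QuotientAddGroup.induction_on with
  | H t =>
    induction t using TensorProduct.induction_on with
    | zero =>
      have h := tmul 0 0
      rw [RelTensor.zero_tmul] at h
      exact h
    | tmul a c => exact tmul a c
    | add s t hs ht => exact add _ _ hs ht

theorem RelTensor.addHom_ext {M : Type*} [AddMonoid M] {u v : RelTensor φ →+ M}
    (h : ∀ a c, u (RelTensor.tmul φ a c) = v (RelTensor.tmul φ a c)) : u = v := by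
  refine DFunLike.ext _ _ fun t => ?_
  induction t using RelTensor.induction φ with
  | tmul a c => exact h a c
  | add s t hs ht => rw [map_add, map_add, hs, ht]

/-- The additive map on `A ⊗_B A` induced by a `B`-balanced biadditive map. -/
def RelTensor.lift {M : Type*} [AddCommGroup M] (g : A →+ A →+ M)
    (hg : ∀ a β c, g (a * φ β) c = g a (φ β * c)) : RelTensor φ →+ M :=
  QuotientAddGroup.lift _ (TensorProduct.liftAddHom (R := ℤ) g fun r a c => by
    rw [map_zsmul, map_zsmul, AddMonoidHom.zsmul_apply])
    ((AddSubgroup.closure_le _).2 (by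
      rintro _ ⟨a, β, c, rfl⟩
      change TensorProduct.liftAddHom (R := ℤ) g _ _ = 0
      rw [map_sub, TensorProduct.liftAddHom_tmul, TensorProduct.liftAddHom_tmul, hg, sub_self]))

theorem RelTensor.lmul_add (a b : A) (t : RelTensor φ) :
    RelTensor.lmul φ (a + b) t = RelTensor.lmul φ a t + RelTensor.lmul φ b t := by
  have h : RelTensor.lmul φ (a + b) = RelTensor.lmul φ a + RelTensor.lmul φ b :=
    RelTensor.addHom_ext φ fun x y => by
      rw [AddMonoidHom.add_apply]
      simp only [RelTensor.lmul_tmul, add_mul, RelTensor.add_tmul]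
  exact DFunLike.congr_fun h t

theorem RelTensor.rmul_add (a b : A) (t : RelTensor φ) :
    RelTensor.rmul φ (a + b) t = RelTensor.rmul φ a t + RelTensor.rmul φ b t := by
  have h : RelTensor.rmul φ (a + b) = RelTensor.rmul φ a + RelTensor.rmul φ b :=
    RelTensor.addHom_ext φ fun x y => by
      rw [AddMonoidHom.add_apply]
      simp only [RelTensor.rmul_tmul, mul_add, RelTensor.tmul_add]
  exact DFunLike.congr_fun h t

theorem RelTensor.lmul_mul (a b : A) (t : RelTensor φ) :
    RelTensor.lmul φ (a * b) t = RelTensor.lmul φ a (RelTensor.lmul φ b t) := by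
  have h : RelTensor.lmul φ (a * b) = (RelTensor.lmul φ a).comp (RelTensor.lmul φ b) :=
    RelTensor.addHom_ext φ fun x y => by
      simp only [AddMonoidHom.comp_apply, RelTensor.lmul_tmul, mul_assoc]
  exact DFunLike.congr_fun h t

theorem RelTensor.rmul_mul (a b : A) (t : RelTensor φ) :
    RelTensor.rmul φ (a * b) t = RelTensor.rmul φ b (RelTensor.rmul φ a t) := by
  have h : RelTensor.rmul φ (a * b) = (RelTensor.rmul φ b).comp (RelTensor.rmul φ a) :=
    RelTensor.addHom_ext φ fun x y => by
      simp only [AddMonoidHom.comp_apply, RelTensor.rmul_tmul, mul_assoc]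
  exact DFunLike.congr_fun h t

theorem RelTensor.rmul_lmul (a b : A) (t : RelTensor φ) :
    RelTensor.rmul φ b (RelTensor.lmul φ a t) = RelTensor.lmul φ a (RelTensor.rmul φ b t) := by
  have h : (RelTensor.rmul φ b).comp (RelTensor.lmul φ a) =
      (RelTensor.lmul φ a).comp (RelTensor.rmul φ b) :=
    RelTensor.addHom_ext φ fun x y => rfl
  exact DFunLike.congr_fun h t

theorem RelTensor.mul_lmul (a : A) (t : RelTensor φ) :
    RelTensor.mul φ (RelTensor.lmul φ a t) = a * RelTensor.mul φ t := by
  have h : (RelTensor.mul φ).comp (RelTensor.lmul φ a) =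
      (AddMonoidHom.mulLeft a).comp (RelTensor.mul φ) :=
    RelTensor.addHom_ext φ fun x y => by
      simp only [AddMonoidHom.comp_apply, RelTensor.lmul_tmul, RelTensor.mul_apply_tmul,
        AddMonoidHom.coe_mulLeft, mul_assoc]
  exact DFunLike.congr_fun h t

/-- Separability is the existence of a separability idempotent. -/
theorem isSeparableExtension_iff :
    IsSeparableExtension φ ↔ ∃ e : RelTensor φ,
      (∀ a, RelTensor.lmul φ a e = RelTensor.rmul φ a e) ∧ RelTensor.mul φ e = 1 := by
  constructor
  · rintro ⟨s, hl, hr, hs⟩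
    refine ⟨s 1, fun a => ?_, hs 1⟩
    rw [← hl, ← hr, mul_one, one_mul]
  · rintro ⟨e, he, h1⟩
    refine ⟨AddMonoidHom.mk' (fun a => RelTensor.lmul φ a e)
      fun a b => RelTensor.lmul_add φ a b e, fun a x => RelTensor.lmul_mul φ a x e,
      fun a x => ?_, fun x => ?_⟩
    · change RelTensor.lmul φ (x * a) e = RelTensor.rmul φ a (RelTensor.lmul φ x e)
      rw [RelTensor.lmul_mul, RelTensor.rmul_lmul, he]
    · change RelTensor.mul φ (RelTensor.lmul φ x e) = x
      rw [RelTensor.mul_lmul, h1, mul_one]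

theorem IsRelDerivation.map_mul_coe {φ : B →+* A} {δ : A →+ A} (hδ : IsRelDerivation φ δ)
    (a : A) (β : B) : δ (a * φ β) = δ a * φ β := by
  rw [hδ.1, hδ.2, mul_zero, add_zero]

/-- For a separability idempotent `e = ∑ e' ⊗ e''`, put `c = ∑ δ(e')e''`. Applying `a ⊗ b ↦ δ(a)b`
to `xe = ex` gives `δ(x) + xc = cx`. -/
theorem IsSeparableExtension.isWeaklySeparableExtension {φ : B →+* A}
    (h : IsSeparableExtension φ) : IsWeaklySeparableExtension φ := by
  obtain ⟨e, he, h1⟩ := (isSeparableExtension_iff φ).1 h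
  intro δ hδ
  let P : RelTensor φ →+ A := RelTensor.lift φ (AddMonoidHom.mul.comp δ) fun a β c => by
    simp [hδ.map_mul_coe, mul_assoc]
  have hP : ∀ a c, P (RelTensor.tmul φ a c) = δ a * c := fun _ _ => rfl
  refine ⟨P e, fun x => ?_⟩
  have hl : P.comp (RelTensor.lmul φ x) =
      (AddMonoidHom.mulLeft (δ x)).comp (RelTensor.mul φ) + (AddMonoidHom.mulLeft x).comp P :=
    RelTensor.addHom_ext φ fun a c => by
      simp [RelTensor.lmul_tmul, hP, RelTensor.mul_apply_tmul, hδ.1, add_mul, mul_assoc]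
  have hr : P.comp (RelTensor.rmul φ x) = (AddMonoidHom.mulRight x).comp P :=
    RelTensor.addHom_ext φ fun a c => by
      simp [RelTensor.rmul_tmul, hP, mul_assoc]
  have hl' : P (RelTensor.lmul φ x e) = δ x * RelTensor.mul φ e + x * P e :=
    DFunLike.congr_fun hl e
  have hr' : P (RelTensor.rmul φ x e) = P e * x := DFunLike.congr_fun hr e
  rw [he, hr', h1, mul_one] at hl'
  exact eq_sub_of_add_eq hl'.symm

end Extension

/-! ### Functionals on the skew polynomial ring and the coefficients of `f` -/

section SkewPoly

variable {B : Type*} [Ring B] (ρ : RingAut B)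

theorem SkewPoly.C_mul_X_pow (α : B) (n : ℕ) :
    SkewPoly.C ρ α * SkewPoly.X ρ ^ n = SkewPoly.X ρ ^ n * SkewPoly.C ρ ((ρ ^ n) α) := by
  induction n generalizing α with
  | zero => simp
  | succ n ih =>
    rw [pow_succ, ← mul_assoc, ih, mul_assoc, SkewPoly.C_mul_X, ← mul_assoc, pow_succ' ρ]
    rfl

theorem SkewPoly.single_eq (n : ℕ) (b : B) :
    (SkewMonoidAlgebra.single (Multiplicative.ofAdd n) b :
      SkewMonoidAlgebra B (Multiplicative ℕ)) =
      (SkewPoly.X ρ ^ n * SkewPoly.C ρ ((ρ ^ n) b) : SkewPoly ρ) := by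
  let := twist ρ
  rw [← SkewPoly.C_mul_X_pow]
  exact (SkewPolynomial.C_mul_X_pow_eq_monomial (a := b) (n := n)).symm

theorem SkewPoly.induction {p : SkewPoly ρ → Prop}
    (monomial : ∀ n b, p (SkewPoly.X ρ ^ n * SkewPoly.C ρ b))
    (add : ∀ s t, p s → p t → p (s + t)) (q : SkewPoly ρ) : p q := by
  let := twist ρ
  refine SkewMonoidAlgebra.induction_on' (k := B) (G := Multiplicative ℕ) (p := p) q
    (fun n b => ?_) add
  have h := SkewPoly.single_eq ρ n.toAdd b
  rw [ofAdd_toAdd] at h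
  rw [h]
  exact monomial _ _

/-- The right `B`-linear functional `∑ Xʲ cⱼ ↦ ∑ uⱼ cⱼ` on `B[X;ρ]`. -/
noncomputable def SkewPoly.functional (u : ℕ → B) : SkewPoly ρ →+ B :=
  -- The stored monomial is `bXⁿ = Xⁿρⁿ(b)`, with its coefficient on the left, so `ρⁿ` is applied
  -- before multiplying by `uₙ`.
  (Finsupp.liftAddHom fun n : Multiplicative ℕ =>
    (AddMonoidHom.mulLeft (u n.toAdd)).comp ((ρ ^ n.toAdd : RingAut B) : B →+ B)).comp
    (SkewMonoidAlgebra.coeffAddEquiv :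
      SkewMonoidAlgebra B (Multiplicative ℕ) ≃+ _).toAddMonoidHom

theorem SkewPoly.functional_X_pow_mul_C (u : ℕ → B) (n : ℕ) (b : B) :
    SkewPoly.functional ρ u (SkewPoly.X ρ ^ n * SkewPoly.C ρ b) = u n * b := by
  have h := SkewPoly.single_eq ρ n ((ρ ^ n).symm b)
  rw [RingEquiv.apply_symm_apply] at h
  rw [← h]
  change (Finsupp.liftAddHom _) (Finsupp.single _ _) = _
  rw [Finsupp.liftAddHom_apply_single]
  change u n * (ρ ^ n) ((ρ ^ n).symm b) = _
  rw [RingEquiv.apply_symm_apply]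

theorem SkewPoly.functional_mul_C (u : ℕ → B) (p : SkewPoly ρ) (b : B) :
    SkewPoly.functional ρ u (p * SkewPoly.C ρ b) = SkewPoly.functional ρ u p * b := by
  induction p using SkewPoly.induction ρ with
  | monomial n c =>
    rw [mul_assoc, ← map_mul, SkewPoly.functional_X_pow_mul_C, SkewPoly.functional_X_pow_mul_C,
      mul_assoc]
  | add s t hs ht => rw [add_mul, map_add, map_add, hs, ht, add_mul]

theorem SkewPoly.functional_X_pow (u : ℕ → B) (n : ℕ) :
    SkewPoly.functional ρ u (SkewPoly.X ρ ^ n) = u n := by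
  simpa using SkewPoly.functional_X_pow_mul_C ρ u n 1

/-- The solution of the linear recurrence `∑_{j ≤ m} u_{n+j} aⱼ = 0`, where `a_m = 1`, with initial
values `w₀, …, w_{m-1}`. -/
def recurrence (m : ℕ) (a w : ℕ → B) (n : ℕ) : B :=
  if n < m then w n else -∑ j : Fin m, recurrence m a w (n - m + j) * a j
termination_by n
decreasing_by omega

theorem recurrence_of_lt {m n : ℕ} (a w : ℕ → B) (h : n < m) : recurrence m a w n = w n := by
  rw [recurrence, if_pos h]

theorem recurrence_add (m n : ℕ) (a w : ℕ → B) :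
    recurrence m a w (n + m) = -∑ j ∈ Finset.range m, recurrence m a w (n + j) * a j := by
  rw [recurrence, if_neg (by omega), Nat.add_sub_cancel,
    Finset.sum_range fun j => recurrence m a w (n + j) * a j]

variable {ρ} {m : ℕ} {a : ℕ → B}

theorem SkewPoly.ofCoeffs_mul_X_pow (hfix : ∀ j ≤ m, ρ (a j) = a j) (n : ℕ) :
    SkewPoly.ofCoeffs ρ m a * SkewPoly.X ρ ^ n = SkewPoly.X ρ ^ n * SkewPoly.ofCoeffs ρ m a := by
  unfold SkewPoly.ofCoeffs
  rw [Finset.sum_mul, Finset.mul_sum]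
  refine Finset.sum_congr rfl fun j hj => ?_
  have h : (ρ ^ n) (a j) = a j := by
    induction n with
    | zero => rfl
    | succ n ih =>
      rw [pow_succ]
      change (ρ ^ n) (ρ (a j)) = a j
      rw [hfix j (Nat.lt_succ_iff.1 (Finset.mem_range.1 hj)), ih]
  rw [mul_assoc, SkewPoly.C_mul_X_pow, h, ← mul_assoc, ← mul_assoc, ← pow_add, ← pow_add, add_comm]

/-- Functionals coming from the recurrence attached to `f` vanish on `f B[X;ρ]`. -/
theorem SkewPoly.functional_ofCoeffs_mul (hfix : ∀ j ≤ m, ρ (a j) = a j) (ham : a m = 1)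
    (w : ℕ → B) (g : SkewPoly ρ) :
    SkewPoly.functional ρ (recurrence m a w) (SkewPoly.ofCoeffs ρ m a * g) = 0 := by
  induction g using SkewPoly.induction ρ with
  | monomial n b =>
    -- As `f` commutes with `X`, the value at `fXⁿb = Xⁿfb` is `(∑ u_{n+j} aⱼ)b`, which the
    -- recurrence makes zero.
    rw [← mul_assoc, SkewPoly.functional_mul_C, SkewPoly.ofCoeffs_mul_X_pow hfix]
    unfold SkewPoly.ofCoeffs
    simp only [Finset.mul_sum, map_sum, ← mul_assoc, ← pow_add, SkewPoly.functional_X_pow_mul_C]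
    rw [Finset.sum_range_succ, ham, mul_one, recurrence_add, add_neg_cancel, zero_mul]
  | add s t hs ht => rw [mul_add, map_add, hs, ht, add_zero]

/-- The commutation rule of the coefficients of an invariant polynomial whose degree is a multiple
of the order of `ρ`. -/
theorem SkewPoly.IsInvariant.coeff_mul (hinv : (SkewPoly.ofCoeffs ρ m a).IsInvariant)
    (hfix : ∀ j ≤ m, ρ (a j) = a j) (ham : a m = 1) (hρ : ρ ^ m = 1) {j : ℕ} (hj : j ≤ m) (α : B) :
    (ρ ^ j) α * a j = a j * α := by
  obtain rfl | hj := hj.eq_or_lt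
  · rw [hρ, ham, one_mul, mul_one]; rfl
  obtain ⟨g, hg⟩ : SkewPoly.C ρ α * SkewPoly.ofCoeffs ρ m a ∈
      {p : SkewPoly ρ | ∃ g, p = SkewPoly.ofCoeffs ρ m a * g} := by
    rw [hinv]
    exact ⟨_, rfl⟩
  -- With `αf = fg`, the element `f(g - α) = αf - fα` is a multiple of `f`, and its terms in `X^m`
  -- cancel because `ρ^m = 1`. On degrees below `m` this functional reads the coefficient of `Xʲ`.
  have key := SkewPoly.functional_ofCoeffs_mul hfix ham (Pi.single j 1) (g - SkewPoly.C ρ α)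
  have hα : ∀ k, SkewPoly.C ρ α * (SkewPoly.X ρ ^ k * SkewPoly.C ρ (a k)) =
      SkewPoly.X ρ ^ k * SkewPoly.C ρ ((ρ ^ k) α * a k) := fun k => by
    rw [← mul_assoc, SkewPoly.C_mul_X_pow, mul_assoc, ← map_mul]
  rw [mul_sub, ← hg] at key
  unfold SkewPoly.ofCoeffs at key
  rw [Finset.mul_sum, Finset.sum_mul, Finset.sum_range_succ, Finset.sum_range_succ, hα m, hρ, ham,
    RingAut.one_apply, mul_one, map_one, mul_one, add_sub_add_right_eq_sub,
    ← Finset.sum_sub_distrib, map_sum, Finset.sum_eq_single j] at key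
  · rw [hα, mul_assoc, ← map_mul, map_sub, SkewPoly.functional_X_pow_mul_C,
      SkewPoly.functional_X_pow_mul_C, recurrence_of_lt _ _ hj, Pi.single_eq_same, one_mul,
      one_mul] at key
    exact sub_eq_zero.1 key
  · intro k hk hkj
    rw [hα, mul_assoc, ← map_mul, map_sub, SkewPoly.functional_X_pow_mul_C,
      SkewPoly.functional_X_pow_mul_C, recurrence_of_lt _ _ (Finset.mem_range.1 hk),
      Pi.single_eq_of_ne hkj, zero_mul, zero_mul, sub_zero]
  · exact fun h => absurd (Finset.mem_range.2 hj) h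

end SkewPoly

/-! ### Derivations of the residue ring and their values at `x` -/

section Residue

variable {B : Type*} [Ring B] {ρ : RingAut B}

theorem Residue.mk_self (f : SkewPoly ρ) : Ideal.Quotient.mk (SkewPoly.ideal f) f = 0 :=
  Ideal.Quotient.eq_zero_iff_mem.2 (TwoSidedIdeal.mem_asIdeal.2 (TwoSidedIdeal.subset_span rfl))

theorem Residue.coe_mul_x (f : SkewPoly ρ) (α : B) :
    Residue.coe f α * Residue.x f = Residue.x f * Residue.coe f (ρ α) :=
  congrArg (Ideal.Quotient.mk (SkewPoly.ideal f)) (SkewPoly.C_mul_X ρ α)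

theorem Residue.coe_mul_x_pow (f : SkewPoly ρ) (α : B) (n : ℕ) :
    Residue.coe f α * Residue.x f ^ n = Residue.x f ^ n * Residue.coe f ((ρ ^ n) α) :=
  congrArg (Ideal.Quotient.mk (SkewPoly.ideal f)) (SkewPoly.C_mul_X_pow ρ α n)

theorem Residue.induction {f : SkewPoly ρ} {p : Residue f → Prop}
    (monomial : ∀ n b, p (Residue.x f ^ n * Residue.coe f b))
    (add : ∀ s t, p s → p t → p (s + t)) (q : Residue f) : p q := by
  obtain ⟨q, rfl⟩ := Ideal.Quotient.mk_surjective q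
  induction q using SkewPoly.induction ρ with
  | monomial n b => exact monomial n b
  | add s t hs ht => rw [map_add]; exact add _ _ hs ht

theorem Residue.mem_center_of_commute {f : SkewPoly ρ} {h : Residue f}
    (hx : h * Residue.x f = Residue.x f * h)
    (hB : ∀ α, Residue.coe f α * h = h * Residue.coe f α) :
    h ∈ Subring.center (Residue f) := by
  refine Subring.mem_center_iff.2 fun g => ?_
  have hC : Commute h (Residue.x f) := hx
  induction g using Residue.induction with
  | monomial n b => rw [mul_assoc, hB, ← mul_assoc, ← (hC.pow_right n).eq, mul_assoc]
  | add s t hs ht => rw [add_mul, mul_add, hs, ht]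

theorem Residue.mem_V {f : SkewPoly ρ} {h : Residue f} :
    h ∈ Residue.V f ↔ ∀ α, Residue.coe f α * h = h * Residue.coe f α := by
  unfold Residue.V
  rw [Subring.mem_centralizer_iff, Set.forall_mem_range]

theorem Residue.innerX_mem_J {f : SkewPoly ρ} {h : Residue f} (hh : h ∈ Residue.V f) :
    Residue.innerX f h ∈ Residue.J f := by
  rw [Residue.mem_V] at hh
  intro α
  unfold Residue.innerX
  rw [mul_sub, sub_mul, ← mul_assoc, hh, mul_assoc, Residue.coe_mul_x, ← mul_assoc, ← mul_assoc,
    Residue.coe_mul_x, mul_assoc (Residue.x f), hh, ← mul_assoc]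

theorem Residue.innerX_add (f : SkewPoly ρ) (h k : Residue f) :
    Residue.innerX f (h + k) = Residue.innerX f h + Residue.innerX f k := by
  unfold Residue.innerX
  rw [add_mul, mul_add, add_sub_add_comm]

theorem Residue.isSubbimodule_J (f : SkewPoly ρ) {S : Subring (Residue f)}
    (hS : S ≤ Residue.V f) : IsSubbimodule S (Residue.J f) := by
  intro s hs h hh
  have hs' := Residue.mem_V.1 (hS hs)
  refine ⟨fun α => ?_, fun α => ?_⟩
  · rw [← mul_assoc, hs', mul_assoc, hh α, mul_assoc]
  · rw [← mul_assoc, hh α, mul_assoc, hs', mul_assoc]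

theorem isSubbimodule_of_le {A : Type*} [Ring A] {S T : Subring A} (h : S ≤ T) :
    IsSubbimodule S T.toAddSubgroup := fun _ hs _ ht =>
  ⟨T.mul_mem (h hs) ht, T.mul_mem ht (h hs)⟩

/-- A `B`-derivation sends `x` into `J_ρ`. -/
theorem IsRelDerivation.map_x_mem_J {f : SkewPoly ρ} {δ : Residue f →+ Residue f}
    (hδ : IsRelDerivation (Residue.coe f) δ) : δ (Residue.x f) ∈ Residue.J f := by
  intro α
  have h := congrArg δ (Residue.coe_mul_x f α)
  rwa [hδ.1, hδ.1, hδ.2, hδ.2, zero_mul, zero_add, mul_zero, add_zero] at h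

/-- A `B`-derivation is determined by its value at `x`. -/
theorem IsRelDerivation.ext_x {f : SkewPoly ρ} {δ ε : Residue f →+ Residue f}
    (hδ : IsRelDerivation (Residue.coe f) δ) (hε : IsRelDerivation (Residue.coe f) ε)
    (h : δ (Residue.x f) = ε (Residue.x f)) : δ = ε := by
  have hpow : ∀ n, δ (Residue.x f ^ n) = ε (Residue.x f ^ n) := by
    intro n
    induction n with
    | zero =>
      rw [pow_zero, ← map_one (Residue.coe f), hδ.2, hε.2]
    | succ n ih => rw [pow_succ, hδ.1, hε.1, ih, h]
  refine DFunLike.ext _ _ fun y => ?_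
  induction y using Residue.induction with
  | monomial n b => rw [hδ.map_mul_coe, hε.map_mul_coe, hpow]
  | add s t hs ht => rw [map_add, map_add, hs, ht]

/-- For `c ∈ V`, the inner derivation of `c` is a `B`-derivation. -/
theorem Residue.isRelDerivation_inner {f : SkewPoly ρ} {c : Residue f} (hc : c ∈ Residue.V f) :
    IsRelDerivation (Residue.coe f) (AddMonoidHom.mulLeft c - AddMonoidHom.mulRight c) := by
  refine ⟨fun y z => ?_, fun β => ?_⟩
  · simp only [AddMonoidHom.sub_apply, AddMonoidHom.coe_mulLeft, AddMonoidHom.coe_mulRight]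
    noncomm_ring
  · simp only [AddMonoidHom.sub_apply, AddMonoidHom.coe_mulLeft, AddMonoidHom.coe_mulRight]
    rw [Residue.mem_V.1 hc, sub_self]

theorem Residue.inner_apply_x {f : SkewPoly ρ} (c : Residue f) :
    (AddMonoidHom.mulLeft c - AddMonoidHom.mulRight c) (Residue.x f) = Residue.innerX f c := rfl

theorem IsRelDerivation.eq_inner {f : SkewPoly ρ} {δ : Residue f →+ Residue f}
    (hδ : IsRelDerivation (Residue.coe f) δ) {c : Residue f} (hc : c ∈ Residue.V f)
    (h : δ (Residue.x f) = Residue.innerX f c) (y : Residue f) : δ y = c * y - y * c :=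
  DFunLike.congr_fun (hδ.ext_x (Residue.isRelDerivation_inner hc) h) y

theorem IsRelDerivation.mem_V_of_eq_inner {f : SkewPoly ρ} {δ : Residue f →+ Residue f}
    (hδ : IsRelDerivation (Residue.coe f) δ) {c : Residue f} (hc : ∀ y, δ y = c * y - y * c) :
    c ∈ Residue.V f := Residue.mem_V.2 fun α => by
  rw [eq_comm, ← sub_eq_zero, ← hc, hδ.2]

/-! ### The automorphism `ρ̃` and the map `τ` -/

variable {m : ℕ} {a : ℕ → B}

theorem Residue.sum_x_pow_mul_coe_eq_zero :
    ∑ j ∈ Finset.range (m + 1), Residue.x (SkewPoly.ofCoeffs ρ m a) ^ j *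
      Residue.coe (SkewPoly.ofCoeffs ρ m a) (a j) = 0 := by
  rw [← Residue.mk_self (SkewPoly.ofCoeffs ρ m a)]
  conv_rhs => arg 2; unfold SkewPoly.ofCoeffs
  simp only [map_sum, map_mul, map_pow]
  rfl

variable (hfix : ∀ j ≤ m, ρ (a j) = a j)

theorem Residue.autTilde_x : Residue.autTilde hfix (Residue.x _) = Residue.x _ :=
  congrArg (Ideal.Quotient.mk _) (SkewPoly.coeffAut_X ρ)

theorem Residue.autTilde_coe (α : B) :
    Residue.autTilde hfix (Residue.coe _ α) = Residue.coe _ (ρ α) :=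
  congrArg (Ideal.Quotient.mk _) (SkewPoly.coeffAut_C ρ α)

theorem Residue.mul_x (h : Residue (SkewPoly.ofCoeffs ρ m a)) :
    h * Residue.x _ = Residue.x _ * Residue.autTilde hfix h := by
  induction h using Residue.induction with
  | monomial n b =>
    rw [map_mul, map_pow, Residue.autTilde_x, Residue.autTilde_coe, mul_assoc, Residue.coe_mul_x,
      ← mul_assoc, ← mul_assoc, ← pow_succ, ← pow_succ']
  | add s t hs ht => rw [add_mul, map_add, mul_add, hs, ht]

theorem Residue.mul_x_pow (h : Residue (SkewPoly.ofCoeffs ρ m a)) (n : ℕ) :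
    h * Residue.x _ ^ n = Residue.x _ ^ n * (Residue.autTilde hfix)^[n] h := by
  induction n with
  | zero => simp
  | succ n ih =>
    rw [pow_succ, ← mul_assoc, ih, mul_assoc, Residue.mul_x hfix, Function.iterate_succ_apply',
      mul_assoc]

theorem Residue.autTilde_iterate_mem_J {h : Residue (SkewPoly.ofCoeffs ρ m a)}
    (hh : h ∈ Residue.J _) (n : ℕ) : (Residue.autTilde hfix)^[n] h ∈ Residue.J _ := by
  induction n with
  | zero => exact hh
  | succ n ih =>
    intro α
    have := congrArg (Residue.autTilde hfix) (ih (ρ.symm α))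
    rwa [map_mul, map_mul, Residue.autTilde_coe, Residue.autTilde_coe, RingEquiv.apply_symm_apply,
      ← Function.iterate_succ_apply' (Residue.autTilde hfix)] at this

theorem Residue.autTilde_iterate_coe (α : B) (n : ℕ) :
    (Residue.autTilde hfix)^[n] (Residue.coe _ α) = Residue.coe _ ((ρ ^ n) α) := by
  induction n with
  | zero => rfl
  | succ n ih =>
    rw [Function.iterate_succ_apply', ih, Residue.autTilde_coe, pow_succ']
    rfl

theorem Residue.mem_fixedV {h : Residue (SkewPoly.ofCoeffs ρ m a)} :
    h ∈ Residue.fixedV hfix ↔ h ∈ Residue.V _ ∧ Residue.autTilde hfix h = h := Iff.rfl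

/-- By `hx = xρ̃(h)`, being fixed by `ρ̃` gives commutation with `x`; membership in `V` gives
commutation with `B`. -/
theorem Residue.fixedV_le_center : Residue.fixedV hfix ≤ Subring.center _ := fun h hh =>
  Residue.mem_center_of_commute
    (by rw [Residue.mul_x hfix, ((Residue.mem_fixedV hfix).1 hh).2])
    (Residue.mem_V.1 ((Residue.mem_fixedV hfix).1 hh).1)

theorem Residue.tau_add (h k : Residue (SkewPoly.ofCoeffs ρ m a)) :
    Residue.tau hfix (h + k) = Residue.tau hfix h + Residue.tau hfix k := by
  unfold Residue.tau
  simp only [iterate_map_add, add_mul, Finset.sum_add_distrib, mul_add]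

theorem Residue.tau_mul {s : Residue (SkewPoly.ofCoeffs ρ m a)} (hs : s ∈ Residue.fixedV hfix)
    (h : Residue (SkewPoly.ofCoeffs ρ m a)) :
    Residue.tau hfix (h * s) = Residue.tau hfix h * s := by
  have hit : ∀ n, (Residue.autTilde hfix)^[n] s = s := fun n =>
    Function.iterate_fixed ((Residue.mem_fixedV hfix).1 hs).2 n
  have hc := Subring.mem_center_iff.1 (Residue.fixedV_le_center hfix hs)
  unfold Residue.tau
  rw [Finset.sum_mul]
  refine Finset.sum_congr rfl fun k _ => ?_
  rw [mul_assoc, Finset.sum_mul]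
  congr 1
  refine Finset.sum_congr rfl fun j _ => ?_
  rw [iterate_map_mul, hit, mul_assoc, ← hc, mul_assoc]

/-- A twisted derivation of `B[X;ρ]` into `A` that kills `B` and sends `X` to `h` sends `f` to
`τ(h)`. -/
theorem SkewPoly.derivation_ofCoeffs
    (D : SkewPoly ρ →+ Residue (SkewPoly.ofCoeffs ρ m a))
    (hD : ∀ p q, D (p * q) =
      D p * Ideal.Quotient.mk _ q + Ideal.Quotient.mk _ p * D q)
    (hC : ∀ α, D (SkewPoly.C ρ α) = 0) :
    D (SkewPoly.ofCoeffs ρ m a) = Residue.tau hfix (D (SkewPoly.X ρ)) := by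
  have h1 : D 1 = 0 := by rw [← map_one (SkewPoly.C ρ), hC]
  have hpow : ∀ k, D (SkewPoly.X ρ ^ (k + 1)) = Residue.x _ ^ k *
      ∑ j ∈ Finset.range (k + 1), (Residue.autTilde hfix)^[j] (D (SkewPoly.X ρ)) := by
    intro k
    induction k with
    | zero => simp
    | succ k ih =>
      rw [pow_succ _ (k + 1), hD, ih, map_pow]
      change _ * Residue.x _ + Residue.x _ ^ (k + 1) * _ = _
      -- Moving the trailing `x` to the left applies `ρ̃` to the whole inner sum, shifting its
      -- exponents by one; the new Leibniz term supplies exponent zero.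
      rw [mul_assoc, Residue.mul_x hfix, ← mul_assoc, ← pow_succ, ← mul_add, map_sum,
        Finset.sum_range_succ' _ (k + 1)]
      simp only [Function.iterate_succ_apply', Function.iterate_zero_apply]
  have hmul : ∀ p α, D (p * SkewPoly.C ρ α) = D p * Residue.coe _ α := by
    intro p α
    rw [hD, hC, mul_zero, add_zero]
    rfl
  conv_lhs => arg 2; unfold SkewPoly.ofCoeffs
  rw [map_sum, Finset.sum_range_succ', pow_zero, hmul, h1, zero_mul, add_zero]
  unfold Residue.tau
  refine Finset.sum_congr rfl fun k _ => ?_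
  rw [hmul, hpow, mul_assoc, Finset.sum_mul]

theorem IsRelDerivation.tau_map_x
    {δ : Residue (SkewPoly.ofCoeffs ρ m a) →+ Residue (SkewPoly.ofCoeffs ρ m a)}
    (hδ : IsRelDerivation (Residue.coe _) δ) : Residue.tau hfix (δ (Residue.x _)) = 0 := by
  have h := SkewPoly.derivation_ofCoeffs hfix
    (δ.comp (Ideal.Quotient.mk _ : SkewPoly ρ →+* Residue (SkewPoly.ofCoeffs ρ m a)))
    (fun p q => by simpa using hδ.1 _ _) hδ.2
  refine h.symm.trans ?_
  simp [Residue.mk_self]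

/-- Every `h ∈ J_ρ` with `τ(h) = 0` is the value at `x` of a `B`-derivation. -/
theorem Residue.exists_isRelDerivation {h : Residue (SkewPoly.ofCoeffs ρ m a)}
    (hh : h ∈ Residue.J _) (hτ : Residue.tau hfix h = 0) :
    ∃ δ : Residue (SkewPoly.ofCoeffs ρ m a) →+ Residue (SkewPoly.ofCoeffs ρ m a),
      IsRelDerivation (Residue.coe _) δ ∧ δ (Residue.x _) = h := by
  let f := SkewPoly.ofCoeffs ρ m a
  let A := Residue f
  -- A derivation is the second component of a ring homomorphism into the dual numbers over `A`.
  -- Sending `X` to `x + εh` respects `αX = Xρ(α)` precisely because `h ∈ J_ρ`.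
  let L : SkewPoly ρ →+* TrivSqZeroExt A A :=
    SkewPoly.lift ρ ((TrivSqZeroExt.inlHom A A).comp (Residue.coe f))
      (TrivSqZeroExt.inl (Residue.x f) + TrivSqZeroExt.inr h) fun α => by
        ext
        · simpa using Residue.coe_mul_x f α
        · simpa using hh α
  have hLC : ∀ α, L (SkewPoly.C ρ α) = TrivSqZeroExt.inl (Residue.coe f α) :=
    SkewPoly.lift_C ρ _ _ _
  have hLX : L (SkewPoly.X ρ) = TrivSqZeroExt.inl (Residue.x f) + TrivSqZeroExt.inr h :=
    SkewPoly.lift_X ρ _ _ _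
  have hfst : ∀ p, (L p).fst = Ideal.Quotient.mk (SkewPoly.ideal f) p := by
    have : ((TrivSqZeroExt.fstHom ℤ A A : TrivSqZeroExt A A →ₐ[ℤ] A) :
        TrivSqZeroExt A A →+* A).comp L = Ideal.Quotient.mk (SkewPoly.ideal f) := by
      refine SkewPoly.hom_ext ρ (fun α => ?_) ?_
      · simp only [RingHom.comp_apply, hLC]; rfl
      · simp only [RingHom.comp_apply, hLX]
        change (TrivSqZeroExt.inl (Residue.x f) + TrivSqZeroExt.inr h).fst = Residue.x f
        simp
    exact fun p => DFunLike.congr_fun this p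
  let D : SkewPoly ρ →+ A := (TrivSqZeroExt.sndHom A A).toAddMonoidHom.comp L.toAddMonoidHom
  have hDdef : ∀ p, D p = (L p).snd := fun _ => rfl
  have hDmul : ∀ p q, D (p * q) = D p * Ideal.Quotient.mk _ q + Ideal.Quotient.mk _ p * D q := by
    intro p q
    rw [hDdef, map_mul, TrivSqZeroExt.snd_mul, hfst, hfst, add_comm]
    rfl
  have hDC : ∀ α, D (SkewPoly.C ρ α) = 0 := by
    intro α
    rw [hDdef, hLC, TrivSqZeroExt.snd_inl]
  have hDX : D (SkewPoly.X ρ) = h := by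
    rw [hDdef, hLX]; simp
  -- The two components of `L f` are `f(x)` and `τ(h)`; both vanish, so `L` descends to `A`.
  have hDf : L f = 0 := by
    refine TrivSqZeroExt.ext ((hfst f).trans (Residue.mk_self f)) ?_
    have := SkewPoly.derivation_ofCoeffs hfix D hDmul hDC
    rw [hDX, hτ] at this
    exact this
  have hker : ∀ p ∈ SkewPoly.ideal f, L p = 0 := by
    have : TwoSidedIdeal.span {f} ≤ TwoSidedIdeal.ker L := by
      rw [TwoSidedIdeal.span_le, Set.singleton_subset_iff]
      exact (TwoSidedIdeal.mem_ker L).2 hDf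
    exact fun p hp => (TwoSidedIdeal.mem_ker L).1 (this (TwoSidedIdeal.mem_asIdeal.1 hp))
  let Lq : A →+* TrivSqZeroExt A A := Ideal.Quotient.lift (SkewPoly.ideal f) L hker
  refine ⟨(TrivSqZeroExt.sndHom A A).toAddMonoidHom.comp Lq.toAddMonoidHom, ⟨fun y z => ?_, hDC⟩, hDX⟩
  obtain ⟨p, rfl⟩ := Ideal.Quotient.mk_surjective y
  obtain ⟨q, rfl⟩ := Ideal.Quotient.mk_surjective z
  exact hDmul p q

theorem Residue.tau_innerX {c : Residue (SkewPoly.ofCoeffs ρ m a)} (hc : c ∈ Residue.V _) :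
    Residue.tau hfix (Residue.innerX _ c) = 0 := by
  rw [← Residue.inner_apply_x]
  exact (Residue.isRelDerivation_inner hc).tau_map_x hfix

/-- Weak separability in terms of `I_x` and `τ`. -/
theorem Residue.isWeaklySeparableExtension_iff :
    IsWeaklySeparableExtension (Residue.coe (SkewPoly.ofCoeffs ρ m a)) ↔
      ∀ h ∈ Residue.J (SkewPoly.ofCoeffs ρ m a), Residue.tau hfix h = 0 →
        ∃ c ∈ Residue.V _, Residue.innerX _ c = h := by
  constructor
  · intro hw h hh h0
    obtain ⟨δ, hδ, hx⟩ := Residue.exists_isRelDerivation hfix hh h0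
    obtain ⟨c, hc⟩ := hw δ hδ
    exact ⟨c, hδ.mem_V_of_eq_inner hc, (hc (Residue.x _)).symm.trans hx⟩
  · intro hex δ hδ
    obtain ⟨c, hcV, hc⟩ := hex _ hδ.map_x_mem_J (hδ.tau_map_x hfix)
    exact ⟨c, hδ.eq_inner hcV hc.symm⟩

theorem Residue.coe_coeff_mul_x_pow (hfix : ∀ j ≤ m, ρ (a j) = a j) {j : ℕ} (hj : j ≤ m) (n : ℕ) :
    Residue.coe (SkewPoly.ofCoeffs ρ m a) (a j) * Residue.x _ ^ n =
      Residue.x _ ^ n * Residue.coe _ (a j) := by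
  have h : Commute (Residue.coe (SkewPoly.ofCoeffs ρ m a) (a j)) (Residue.x _) := by
    have := Residue.coe_mul_x (SkewPoly.ofCoeffs ρ m a) (a j)
    rwa [hfix j hj] at this
  exact (h.pow_right n).eq

theorem Residue.coe_coeff_mul_of_mem_J (hfix : ∀ j ≤ m, ρ (a j) = a j) 
    {h : Residue (SkewPoly.ofCoeffs ρ m a)}
    (hh : h ∈ Residue.J _) {j : ℕ} (hj : j ≤ m) :
    Residue.coe _ (a j) * h = h * Residue.coe _ (a j) := by
  have := hh (a j)
  rwa [hfix j hj] at this

/-- The coefficient rule extends from `B` to `A` because `x` is fixed by `ρ̃` and commutes with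
`aⱼ`. -/
theorem Residue.autTilde_iterate_mul_coe
    (hcoeff : ∀ j ≤ m, ∀ α, (ρ ^ j) α * a j = a j * α) {j : ℕ} (hj : j ≤ m)
    (h : Residue (SkewPoly.ofCoeffs ρ m a)) :
    (Residue.autTilde hfix)^[j] h * Residue.coe _ (a j) = Residue.coe _ (a j) * h := by
  induction h using Residue.induction with
  | monomial n b =>
    have hx : (Residue.autTilde hfix)^[j] (Residue.x _) = Residue.x _ :=
      Function.iterate_fixed (Residue.autTilde_x hfix) j
    rw [iterate_map_mul, iterate_map_pow, hx, Residue.autTilde_iterate_coe, mul_assoc, ← map_mul,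
      hcoeff j hj, map_mul, ← mul_assoc, ← mul_assoc, Residue.coe_coeff_mul_x_pow hfix hj]
  | add s t hs ht => rw [iterate_map_add, add_mul, hs, ht, mul_add]

theorem Residue.tau_mem_fixedV
    (hcoeff : ∀ j ≤ m, ∀ α, (ρ ^ j) α * a j = a j * α) {h : Residue (SkewPoly.ofCoeffs ρ m a)} (hh : h ∈ Residue.J _) :
    Residue.tau hfix h ∈ Residue.fixedV hfix := by
  refine (Residue.mem_fixedV hfix).2 ⟨Residue.mem_V.2 fun α => ?_, ?_⟩
  · unfold Residue.tau
    rw [Finset.mul_sum, Finset.sum_mul]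
    refine Finset.sum_congr rfl fun k hk => ?_
    rw [← mul_assoc, Residue.coe_mul_x_pow, mul_assoc, mul_assoc, Finset.mul_sum, Finset.sum_mul]
    congr 1
    refine Finset.sum_congr rfl fun j _ => ?_
    -- Passing `xᵏ` twists `α` by `ρᵏ`, and passing `ρ̃ʲ(h) ∈ J_ρ` by one more `ρ`: exactly the
    -- twist that `a_{k+1}` undoes.
    have e : ρ ((ρ ^ k) α) = (ρ ^ (k + 1)) α := by rw [pow_succ']; rfl
    rw [← mul_assoc, Residue.autTilde_iterate_mem_J hfix hh j, mul_assoc, mul_assoc, ← map_mul,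
      ← map_mul, e, hcoeff _ (Finset.mem_range.1 hk)]
  · unfold Residue.tau
    rw [map_sum]
    refine Finset.sum_congr rfl fun k hk => ?_
    have hk' : k + 1 ≤ m := Finset.mem_range.1 hk
    rw [map_mul, map_pow, Residue.autTilde_x, map_sum]
    congr 1
    -- Applying `ρ̃` shifts the inner sum, trading its first term `h a_{k+1}` for `ρ̃^{k+1}(h)
    -- a_{k+1}`. The latter is `a_{k+1}h`, which equals `h a_{k+1}` since `h ∈ J_ρ` and `ρ` fixes
    -- `a_{k+1}`.
    rw [Finset.sum_congr rfl fun j _ => by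
      rw [map_mul, Residue.autTilde_coe, hfix _ hk', ← Function.iterate_succ_apply' (Residue.autTilde hfix)],
      Finset.sum_range_succ, Finset.sum_range_succ',
      Residue.autTilde_iterate_mul_coe hfix hcoeff hk', Residue.coe_coeff_mul_of_mem_J hfix hh hk',
      Function.iterate_zero_apply]

end Residue

/-! ### The last-coefficient functional and its dual basis -/

section Separable

variable {B : Type*} [Ring B] {ρ : RingAut B} {m : ℕ} {a : ℕ → B}

/-- Among the initial values only index `m - 1` is nonzero, where the claim is trivial. The
recurrence propagates it: `ρʲ(β)aⱼ = aⱼβ` carries the twist across each coefficient, and `ρ^m = 1`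
absorbs the shift by `m`. -/
theorem recurrence_mul_pow (hρ : ρ ^ m = 1)
    (hcoeff : ∀ j ≤ m, ∀ α, (ρ ^ j) α * a j = a j * α) (α : B) (n : ℕ) :
    recurrence m a (Pi.single (m - 1) 1) n * (ρ ^ n) α =
      (ρ ^ (m - 1)) α * recurrence m a (Pi.single (m - 1) 1) n := by
  induction n using Nat.strong_induction_on with
  | _ n ih =>
    obtain hn | hn := lt_or_ge n m
    · rw [recurrence_of_lt _ _ hn]
      obtain rfl | hne := eq_or_ne n (m - 1)
      · rw [Pi.single_eq_same, one_mul, mul_one]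
      · rw [Pi.single_eq_of_ne hne, zero_mul, mul_zero]
    · obtain ⟨k, rfl⟩ := Nat.exists_eq_add_of_le' hn
      rw [recurrence_add, pow_add, hρ, mul_one, neg_mul, mul_neg, Finset.sum_mul, Finset.mul_sum]
      refine congrArg _ (Finset.sum_congr rfl fun j hj => ?_)
      have hj' := Finset.mem_range.1 hj
      have e : (ρ ^ j) ((ρ ^ k) α) = (ρ ^ (k + j)) α := by rw [add_comm, pow_add]; rfl
      rw [mul_assoc, ← hcoeff j hj'.le, e, ← mul_assoc, ih (k + j) (by omega), mul_assoc]

theorem SkewPoly.functional_C_mul (hm : 0 < m) (hρ : ρ ^ m = 1)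
    (hcoeff : ∀ j ≤ m, ∀ α, (ρ ^ j) α * a j = a j * α) (α : B) (p : SkewPoly ρ) :
    SkewPoly.functional ρ (recurrence m a (Pi.single (m - 1) 1)) (SkewPoly.C ρ (ρ α) * p) =
      α * SkewPoly.functional ρ (recurrence m a (Pi.single (m - 1) 1)) p := by
  induction p using SkewPoly.induction ρ with
  | monomial n b =>
    have e : (ρ ^ (m - 1)) (ρ α) = α := by
      change (ρ ^ (m - 1) * ρ) α = α
      rw [← pow_succ, Nat.sub_add_cancel hm, hρ]
      rfl
    rw [← mul_assoc, SkewPoly.C_mul_X_pow, mul_assoc, ← map_mul, SkewPoly.functional_X_pow_mul_C,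
      SkewPoly.functional_X_pow_mul_C, ← mul_assoc, recurrence_mul_pow hρ hcoeff, e, mul_assoc]
  | add s t hs ht => rw [mul_add, map_add, map_add, hs, ht, mul_add]

/-- The functional `∑_{j < m} xʲ cⱼ ↦ c_{m-1}` on `A`. -/
noncomputable def Residue.lastCoeff (hinv : (SkewPoly.ofCoeffs ρ m a).IsInvariant)
    (hfix : ∀ j ≤ m, ρ (a j) = a j) (ham : a m = 1) :
    Residue (SkewPoly.ofCoeffs ρ m a) →+ B :=
  -- Initial values `0, …, 0, 1` select the coefficient of `x^{m-1}`. Invariance identifies the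
  -- ideal with the right multiples of `f`, on which the functional vanishes.
  QuotientAddGroup.lift (SkewPoly.ideal (SkewPoly.ofCoeffs ρ m a)).toAddSubgroup
    (SkewPoly.functional ρ (recurrence m a (Pi.single (m - 1) 1))) (by
      intro p hp
      obtain ⟨g, rfl⟩ := (SkewPoly.mem_ideal_iff hinv p).1 hp
      exact SkewPoly.functional_ofCoeffs_mul hfix ham _ g)

variable (hinv : (SkewPoly.ofCoeffs ρ m a).IsInvariant)
  (hfix : ∀ j ≤ m, ρ (a j) = a j) (ham : a m = 1)

theorem Residue.lastCoeff_mul_coe (y : Residue (SkewPoly.ofCoeffs ρ m a)) (β : B) :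
    Residue.lastCoeff hinv hfix ham (y * Residue.coe _ β) =
      Residue.lastCoeff hinv hfix ham y * β := by
  obtain ⟨p, rfl⟩ := Ideal.Quotient.mk_surjective y
  exact SkewPoly.functional_mul_C ρ _ p β

theorem Residue.lastCoeff_coe_mul (hm : 0 < m) (hρ : ρ ^ m = 1)
    (α : B) (y : Residue (SkewPoly.ofCoeffs ρ m a)) :
    Residue.lastCoeff hinv hfix ham (Residue.coe _ (ρ α) * y) =
      α * Residue.lastCoeff hinv hfix ham y := by
  obtain ⟨p, rfl⟩ := Ideal.Quotient.mk_surjective y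
  exact SkewPoly.functional_C_mul hm hρ
    (fun _ hj => hinv.coeff_mul hfix ham hρ hj) α p

theorem Residue.lastCoeff_x_pow {n : ℕ} (hn : n < m) :
    Residue.lastCoeff hinv hfix ham (Residue.x _ ^ n) = if n = m - 1 then 1 else 0 := by
  have h := SkewPoly.functional_X_pow ρ (recurrence m a (Pi.single (m - 1) 1)) n
  rw [recurrence_of_lt _ _ hn, Pi.single_apply] at h
  exact h

/-- The elements `yⱼ = ∑_{k ≥ j} x^{k-j} a_{k+1}` dual to the powers of `x`. -/
noncomputable def Residue.dual (ρ : RingAut B) (m : ℕ) (a : ℕ → B) (j : ℕ) :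
    Residue (SkewPoly.ofCoeffs ρ m a) :=
  ∑ l ∈ Finset.range (m - j), Residue.x _ ^ l * Residue.coe _ (a (j + l + 1))

theorem Residue.dual_eq {j : ℕ} (hj : j < m) :
    Residue.dual ρ m a j =
      Residue.coe _ (a (j + 1)) + Residue.x _ * Residue.dual ρ m a (j + 1) := by
  unfold Residue.dual
  obtain ⟨n, hn⟩ : ∃ n, m - j = n + 1 := ⟨m - j - 1, by omega⟩
  rw [hn, show m - (j + 1) = n by omega, Finset.sum_range_succ', Finset.mul_sum, add_comm,
    pow_zero, one_mul, add_zero]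
  congr 1
  refine Finset.sum_congr rfl fun l _ => ?_
  rw [pow_succ', mul_assoc, show j + (l + 1) + 1 = j + 1 + l + 1 by omega]

theorem Residue.dual_self : Residue.dual ρ m a m = 0 := by
  unfold Residue.dual
  rw [Nat.sub_self, Finset.sum_range_zero]

/-- This is `f(x) = 0` with the constant term moved across. -/
theorem Residue.x_mul_dual_zero :
    Residue.x _ * Residue.dual ρ m a 0 = -Residue.coe _ (a 0) := by
  have h := Residue.sum_x_pow_mul_coe_eq_zero (ρ := ρ) (m := m) (a := a)
  rw [Finset.sum_range_succ', pow_zero, one_mul] at h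
  rw [← eq_neg_of_add_eq_zero_left h]
  unfold Residue.dual
  rw [Finset.mul_sum, Nat.sub_zero]
  refine Finset.sum_congr rfl fun l _ => ?_
  rw [pow_succ', mul_assoc, zero_add]

theorem Residue.dual_mul_x (hfix : ∀ j ≤ m, ρ (a j) = a j) (j : ℕ) :
    Residue.dual ρ m a j * Residue.x _ = Residue.x _ * Residue.dual ρ m a j := by
  unfold Residue.dual
  rw [Finset.sum_mul, Finset.mul_sum]
  refine Finset.sum_congr rfl fun l hl => ?_
  have hl' := Finset.mem_range.1 hl
  have h := Residue.coe_coeff_mul_x_pow hfix (show j + l + 1 ≤ m by omega) 1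
  rw [pow_one] at h
  rw [mul_assoc, h, ← mul_assoc, ← mul_assoc, ← pow_succ, ← pow_succ']

/-- The sum `yⱼ` stops at `x^{m-1-j}`, so `x^{m-1}` appears only for `j = 0`, with coefficient `a_m
= 1`. -/
theorem Residue.lastCoeff_dual {j : ℕ} (hj : j < m) :
    Residue.lastCoeff hinv hfix ham (Residue.dual ρ m a j) = if j = 0 then 1 else 0 := by
  unfold Residue.dual
  rw [map_sum, Finset.sum_congr rfl fun l hl => by
    rw [Residue.lastCoeff_mul_coe, Residue.lastCoeff_x_pow hinv hfix ham
      (show l < m by have := Finset.mem_range.1 hl; omega)]]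
  split_ifs with h
  · subst h
    rw [Finset.sum_eq_single (m - 1)]
    · rw [if_pos rfl, one_mul, show 0 + (m - 1) + 1 = m by omega, ham]
    · intro l _ hl
      rw [if_neg hl, zero_mul]
    · intro hl
      exact absurd (Finset.mem_range.2 (by omega)) hl
  · refine Finset.sum_eq_zero fun l hl => ?_
    have := Finset.mem_range.1 hl
    rw [if_neg (by omega), zero_mul]

/-- The expansion of an element of `A` in powers of `x`. -/
theorem Residue.sum_x_pow_mul_lastCoeff (hm : 0 < m) (hρ : ρ ^ m = 1)
    (y : Residue (SkewPoly.ofCoeffs ρ m a)) :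
    ∑ j ∈ Finset.range m, Residue.x _ ^ j *
      Residue.coe _ (Residue.lastCoeff hinv hfix ham (Residue.dual ρ m a j * y)) = y := by
  induction y using Residue.induction with
  | add s t hs ht => simp only [mul_add, map_add, Finset.sum_add_distrib, hs, ht]
  | monomial n b =>
    simp only [← mul_assoc, Residue.lastCoeff_mul_coe, map_mul]
    rw [← Finset.sum_mul]
    congr 1
    induction n with
    | zero =>
      rw [Finset.sum_eq_single 0]
      · rw [pow_zero, mul_one, Residue.lastCoeff_dual hinv hfix ham hm, if_pos rfl, map_one,
          one_mul]
      · intro j hj hj0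
        rw [pow_zero, mul_one, Residue.lastCoeff_dual hinv hfix ham (Finset.mem_range.1 hj),
          if_neg hj0, map_zero, mul_zero]
      · intro h
        exact absurd (Finset.mem_range.2 hm) h
    | succ n ih =>
      -- Because `ρ` fixes `aⱼ`, the twisted left linearity of `π` is untwisted on coefficients.
      have hcoe : ∀ j ≤ m, ∀ y, Residue.lastCoeff hinv hfix ham (Residue.coe _ (a j) * y) =
          a j * Residue.lastCoeff hinv hfix ham y := fun j hj y => by
        conv_lhs => rw [← hfix j hj]
        exact Residue.lastCoeff_coe_mul hinv hfix ham hm hρ (a j) y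
      -- From `x y_{j+1} = yⱼ - a_{j+1}`: multiplying by `x` shifts the coordinates and subtracts a
      -- multiple of the coefficients of `f`.
      have hstep : ∀ j < m, Residue.lastCoeff hinv hfix ham
          (Residue.dual ρ m a (j + 1) * Residue.x _ ^ (n + 1)) =
          Residue.lastCoeff hinv hfix ham (Residue.dual ρ m a j * Residue.x _ ^ n) -
            a (j + 1) * Residue.lastCoeff hinv hfix ham (Residue.x _ ^ n) := fun j hj => by
        rw [pow_succ', ← mul_assoc, Residue.dual_mul_x hfix,
          ← sub_eq_of_eq_add' (Residue.dual_eq hj), sub_mul, map_sub, hcoe _ hj]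
      have hterm : ∀ j < m, Residue.x _ ^ (j + 1) * Residue.coe _ (Residue.lastCoeff hinv hfix ham
          (Residue.dual ρ m a (j + 1) * Residue.x _ ^ (n + 1))) =
          Residue.x _ * (Residue.x _ ^ j * Residue.coe _ (Residue.lastCoeff hinv hfix ham
            (Residue.dual ρ m a j * Residue.x _ ^ n))) -
          Residue.x _ ^ (j + 1) * Residue.coe (SkewPoly.ofCoeffs ρ m a) (a (j + 1)) *
            Residue.coe _ (Residue.lastCoeff hinv hfix ham (Residue.x _ ^ n)) := fun j hj => by
        rw [hstep j hj, map_sub, mul_sub, map_mul (Residue.coe _) (a (j + 1)), ← mul_assoc,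
          ← mul_assoc, ← pow_succ']
      have hzero : Residue.lastCoeff hinv hfix ham
          (Residue.dual ρ m a 0 * Residue.x _ ^ (n + 1)) =
          -(a 0 * Residue.lastCoeff hinv hfix ham (Residue.x _ ^ n)) := by
        rw [pow_succ', ← mul_assoc, Residue.dual_mul_x hfix, Residue.x_mul_dual_zero, neg_mul,
          map_neg, hcoe 0 (Nat.zero_le m)]
      -- Since `y_m = 0`, index `m` can be added freely; splitting off index `0` then leaves all `j
      -- + 1` with `j < m`.
      have htop : ∀ g : ℕ → Residue (SkewPoly.ofCoeffs ρ m a), g m = 0 →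
          ∑ j ∈ Finset.range m, g j = ∑ j ∈ Finset.range (m + 1), g j := fun g hg => by
        rw [Finset.sum_range_succ, hg, add_zero]
      have hf := Residue.sum_x_pow_mul_coe_eq_zero (ρ := ρ) (m := m) (a := a)
      rw [Finset.sum_range_succ', pow_zero, one_mul] at hf
      rw [htop _ (by rw [Residue.dual_self, zero_mul, map_zero, map_zero, mul_zero]),
        Finset.sum_range_succ', hzero, pow_zero, one_mul,
        Finset.sum_congr rfl fun j hj => hterm j (Finset.mem_range.1 hj),
        Finset.sum_sub_distrib, ← Finset.mul_sum, ih, ← Finset.sum_mul, map_neg, map_mul,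
        ← sub_eq_add_neg, sub_sub, ← add_mul, ← pow_succ']
      -- What remains is `x^{n+1} - f(x)π(xⁿ)`.
      rw [hf, zero_mul, sub_zero]

/-- Group the double sum by total degree `k` in `x` and move the inner power of `x` left past `h`,
which turns `h` into an iterate `ρ̃ʲ(h)`. -/
theorem Residue.sum_x_pow_mul_mul_dual (h : Residue (SkewPoly.ofCoeffs ρ m a)) :
    ∑ j ∈ Finset.range m, Residue.x _ ^ j * h * Residue.dual ρ m a j = Residue.tau hfix h := by
  unfold Residue.dual Residue.tau
  simp only [Finset.mul_sum]
  rw [← Finset.sum_range_diag_flip m fun j l =>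
    Residue.x _ ^ j * h * (Residue.x _ ^ l * Residue.coe _ (a (j + l + 1)))]
  refine Finset.sum_congr rfl fun k _ => ?_
  rw [← Finset.sum_range_reflect]
  refine Finset.sum_congr rfl fun j hj => ?_
  have hj' := Finset.mem_range.1 hj
  rw [show k + 1 - 1 - j = k - j by omega, show k - (k - j) = j by omega,
    show k - j + j = k by omega, ← mul_assoc, mul_assoc (Residue.x _ ^ (k - j)),
    Residue.mul_x_pow hfix, ← mul_assoc, ← pow_add, show k - j + j = k by omega, mul_assoc]

/-! ### Separability and the equation `τ(h) = 1` -/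

/-- A separability idempotent gives an element of `J_ρ` with `τ(h) = 1`. -/
theorem Residue.exists_tau_eq_one_of_isSeparable
    (hinv : (SkewPoly.ofCoeffs ρ m a).IsInvariant) (ham : a m = 1) (hm : 0 < m) (hρ : ρ ^ m = 1)
    (hs : IsSeparableExtension (Residue.coe (SkewPoly.ofCoeffs ρ m a))) :
    ∃ h ∈ Residue.J (SkewPoly.ofCoeffs ρ m a), Residue.tau hfix h = 1 := by
  obtain ⟨e, he, h1⟩ := (isSeparableExtension_iff _).1 hs
  let f := SkewPoly.ofCoeffs ρ m a
  let π := Residue.lastCoeff hinv hfix ham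
  -- `Q(y ⊗ z) = π(y)z`; balancedness is the right `B`-linearity of `π`.
  let Q : RelTensor (Residue.coe f) →+ Residue f := RelTensor.lift (Residue.coe f)
    (AddMonoidHom.mul.comp ((Residue.coe f).toAddMonoidHom.comp π)) fun y β z => by
      change Residue.coe f (π (y * Residue.coe f β)) * z =
        Residue.coe f (π y) * (Residue.coe f β * z)
      rw [Residue.lastCoeff_mul_coe, map_mul, mul_assoc]
  have hQ : ∀ y z, Q (RelTensor.tmul _ y z) = Residue.coe f (π y) * z := fun _ _ => rfl
  have hQr : ∀ y t, Q (RelTensor.rmul _ y t) = Q t * y := fun y t => by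
    have : Q.comp (RelTensor.rmul _ y) = (AddMonoidHom.mulRight y).comp Q :=
      RelTensor.addHom_ext _ fun u v => by
        simp [RelTensor.rmul_tmul, hQ, mul_assoc]
    exact DFunLike.congr_fun this t
  have hQl : ∀ α t, Q (RelTensor.lmul _ (Residue.coe f (ρ α)) t) = Residue.coe f α * Q t :=
    fun α t => by
    have : Q.comp (RelTensor.lmul _ (Residue.coe f (ρ α))) =
        (AddMonoidHom.mulLeft (Residue.coe f α)).comp Q :=
      RelTensor.addHom_ext _ fun u v => by
        have := Residue.lastCoeff_coe_mul hinv hfix ham hm hρ α u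
        simp only [AddMonoidHom.comp_apply, RelTensor.lmul_tmul, hQ, AddMonoidHom.coe_mulLeft]
        rw [this, map_mul, mul_assoc]
    exact DFunLike.congr_fun this t
  -- The expansion `y = ∑ xʲ π(yⱼy)` is applied to the left tensor factor.
  have hmul : ∀ t, ∑ j ∈ Finset.range m, Residue.x f ^ j *
      Q (RelTensor.lmul _ (Residue.dual ρ m a j) t) = RelTensor.mul _ t := fun t => by
    have : ∑ j ∈ Finset.range m, (AddMonoidHom.mulLeft (Residue.x f ^ j)).comp
        (Q.comp (RelTensor.lmul _ (Residue.dual ρ m a j))) = RelTensor.mul (Residue.coe f) :=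
      RelTensor.addHom_ext _ fun u v => by
        rw [AddMonoidHom.finsetSum_apply]
        simp only [AddMonoidHom.comp_apply, RelTensor.lmul_tmul, hQ, AddMonoidHom.coe_mulLeft,
          RelTensor.mul_apply_tmul, ← mul_assoc]
        rw [← Finset.sum_mul, Residue.sum_x_pow_mul_lastCoeff hinv hfix ham hm hρ]
    rw [← this, AddMonoidHom.finsetSum_apply]
    rfl
  refine ⟨Q e, fun α => ?_, ?_⟩
  · rw [← hQl, he, hQr]
  -- Since `yⱼe = eyⱼ`, one has `Q(yⱼe) = Q(e)yⱼ`, and the sum becomes `τ(Q(e))`.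
  · rw [← Residue.sum_x_pow_mul_mul_dual, ← h1, ← hmul e]
    refine Finset.sum_congr rfl fun j _ => ?_
    rw [he, hQr, mul_assoc]

/-- An element of `J_ρ` with `τ(h) = 1` gives a separability idempotent. -/
theorem Residue.isSeparable_of_tau_eq_one
    (hcoeff : ∀ j ≤ m, ∀ α, (ρ ^ j) α * a j = a j * α)
    {h : Residue (SkewPoly.ofCoeffs ρ m a)} (hh : h ∈ Residue.J _)
    (hτ : Residue.tau hfix h = 1) :
    IsSeparableExtension (Residue.coe (SkewPoly.ofCoeffs ρ m a)) := by
  rw [isSeparableExtension_iff]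
  let f := SkewPoly.ofCoeffs ρ m a
  let φ := Residue.coe f
  -- This is `∑ xⁱh ⊗ yᵢ` grouped by total degree, so its product is `τ(h)`.
  let e : RelTensor φ := ∑ k ∈ Finset.range m, ∑ j ∈ Finset.range (k + 1),
    RelTensor.tmul φ (Residue.x f ^ (k - j) * h) (Residue.x f ^ j * φ (a (k + 1)))
  have heB : ∀ α, RelTensor.lmul φ (φ α) e = RelTensor.rmul φ (φ α) e := fun α => by
    simp only [e, map_sum, RelTensor.lmul_tmul, RelTensor.rmul_tmul]
    refine Finset.sum_congr rfl fun k hk => Finset.sum_congr rfl fun j hj => ?_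
    have hj' := Finset.mem_range.1 hj
    -- Passing `x^{k-j}`, `h` and `xʲ` twists `α` by `k - j`, `1` and `j` powers of `ρ`, for a total
    -- of `k + 1`, matching the index of `a_{k+1}`.
    have e1 : (ρ ^ j) (ρ ((ρ ^ (k - j)) α)) = (ρ ^ (k + 1)) α := by
      rw [show k + 1 = j + (1 + (k - j)) by omega, pow_add, pow_add, pow_one]
      rfl
    rw [← mul_assoc, Residue.coe_mul_x_pow, mul_assoc, hh, ← mul_assoc, RelTensor.mul_tmul,
      ← mul_assoc, Residue.coe_mul_x_pow, e1, mul_assoc, ← map_mul,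
      hcoeff _ (Finset.mem_range.1 hk), map_mul, mul_assoc]
  have hex : RelTensor.lmul φ (Residue.x f) e = RelTensor.rmul φ (Residue.x f) e := by
    rw [← sub_eq_zero]
    simp only [e, map_sum, RelTensor.lmul_tmul, RelTensor.rmul_tmul]
    rw [← Finset.sum_sub_distrib]
    -- For fixed `k`, multiplying by `x` on the left or the right gives neighbouring terms of one
    -- sequence, so the difference telescopes to its two ends.
    have hk : ∀ k ∈ Finset.range m,
        ∑ j ∈ Finset.range (k + 1),
          RelTensor.tmul φ (Residue.x f * (Residue.x f ^ (k - j) * h))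
            (Residue.x f ^ j * φ (a (k + 1))) -
        ∑ j ∈ Finset.range (k + 1), RelTensor.tmul φ (Residue.x f ^ (k - j) * h)
            (Residue.x f ^ j * φ (a (k + 1)) * Residue.x f) =
        RelTensor.tmul φ (Residue.x f ^ (k + 1) * φ (a (k + 1)) * h) 1 -
          RelTensor.tmul φ h (Residue.x f ^ (k + 1) * φ (a (k + 1))) := fun k hk => by
      have hk' : k + 1 ≤ m := Finset.mem_range.1 hk
      have hx := Residue.coe_coeff_mul_x_pow hfix hk' 1
      rw [pow_one] at hx
      have htel := Finset.sum_range_sub' (fun j => RelTensor.tmul φ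
        (Residue.x f ^ (k + 1 - j) * h) (Residue.x f ^ j * φ (a (k + 1)))) (k + 1)
      rw [← Finset.sum_sub_distrib]
      refine (Finset.sum_congr rfl fun j hj => ?_).trans (htel.trans ?_)
      · have hj' := Finset.mem_range.1 hj
        rw [← mul_assoc, ← pow_succ', mul_assoc (Residue.x f ^ j), hx, ← mul_assoc, ← pow_succ,
          show k - j + 1 = k + 1 - j by omega, show k + 1 - (j + 1) = k - j by omega]
      · simp only [Nat.sub_zero, Nat.sub_self, pow_zero, one_mul]
        rw [mul_assoc, Residue.coe_coeff_mul_of_mem_J hfix hh hk', ← mul_assoc, RelTensor.mul_tmul,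
          mul_one]
    rw [Finset.sum_congr rfl hk, Finset.sum_sub_distrib, ← RelTensor.sum_tmul,
      ← RelTensor.tmul_sum, ← Finset.sum_mul]
    have hf := Residue.sum_x_pow_mul_coe_eq_zero (ρ := ρ) (m := m) (a := a)
    rw [Finset.sum_range_succ', pow_zero, one_mul] at hf
    -- Summed over `k`, both ends involve `f(x) - a₀ = -a₀`, and `a₀h ⊗ 1 = h ⊗ a₀` makes them
    -- cancel.
    rw [eq_neg_of_add_eq_zero_left hf, neg_mul,
      Residue.coe_coeff_mul_of_mem_J hfix hh (Nat.zero_le m), ← mul_neg, ← map_neg,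
      RelTensor.mul_tmul, mul_one, sub_self]
  refine ⟨e, fun y => ?_, ?_⟩
  · induction y using Residue.induction with
    | monomial n b =>
      have hpow : RelTensor.lmul φ (Residue.x f ^ n) e = RelTensor.rmul φ (Residue.x f ^ n) e := by
        induction n with
        | zero => rw [pow_zero, ← map_one φ, heB]
        | succ n ih =>
          rw [pow_succ, RelTensor.lmul_mul, hex, ← RelTensor.rmul_lmul, ih, ← RelTensor.rmul_mul]
      rw [RelTensor.lmul_mul, heB, ← RelTensor.rmul_lmul, hpow, ← RelTensor.rmul_mul]
    | add s t hs ht => rw [RelTensor.lmul_add, RelTensor.rmul_add, hs, ht]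
  · rw [← hτ]
    simp only [e, map_sum]
    unfold Residue.tau
    refine Finset.sum_congr rfl fun k _ => ?_
    rw [Finset.mul_sum]
    refine Finset.sum_congr rfl fun j hj => ?_
    have hj' := Finset.mem_range.1 hj
    change Residue.x f ^ (k - j) * h * (Residue.x f ^ j * φ (a (k + 1))) = _
    rw [← mul_assoc, mul_assoc _ h, Residue.mul_x_pow hfix, ← mul_assoc, ← pow_add,
      show k - j + j = k by omega, mul_assoc]

end Separable

end SkewSep

/-! ### Assembly of the two exact sequences -/

open SkewSep

theorem mainTheorem3 {B : Type*} [Ring B] (ρ : RingAut B) (m : ℕ) (hm : 0 < m)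
    (hρ : orderOf ρ = m) (a : ℕ → B) (ham : a m = 1)
    (hinv : (SkewPoly.ofCoeffs ρ m a).IsInvariant)
    (hfix : ∀ j ≤ m, ρ (a j) = a j) :
    -- the three maps of the sequence are well defined `V^ρ̃`-`V^ρ̃`-homomorphisms
    ∃ (inj : (Subring.center (Residue (SkewPoly.ofCoeffs ρ m a))).toAddSubgroup →+
          (Residue.V (SkewPoly.ofCoeffs ρ m a)).toAddSubgroup)
      (I : (Residue.V (SkewPoly.ofCoeffs ρ m a)).toAddSubgroup →+
          Residue.J (SkewPoly.ofCoeffs ρ m a))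
      (τ : Residue.J (SkewPoly.ofCoeffs ρ m a) →+
          (Residue.fixedV hfix).toAddSubgroup),
      (∀ c, (inj c : Residue (SkewPoly.ofCoeffs ρ m a)) = c) ∧
      (∀ h, (I h : Residue (SkewPoly.ofCoeffs ρ m a)) =
        Residue.innerX _ h) ∧
      (∀ h, (τ h : Residue (SkewPoly.ofCoeffs ρ m a)) =
        Residue.tau hfix h) ∧
      IsBimoduleHom (Residue.fixedV hfix) inj ∧
      IsBimoduleHom (Residue.fixedV hfix) I ∧
      IsBimoduleHom (Residue.fixedV hfix) τ ∧
      (IsWeaklySeparableExtension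
          (Residue.coe (SkewPoly.ofCoeffs ρ m a)) ↔
        Function.Injective inj ∧ Function.Exact inj I ∧ Function.Exact I τ) ∧
      (IsSeparableExtension
          (Residue.coe (SkewPoly.ofCoeffs ρ m a)) ↔
        Function.Injective inj ∧ Function.Exact inj I ∧ Function.Exact I τ ∧
          Function.Surjective τ) := by
  have hρm : ρ ^ m = 1 := hρ ▸ pow_orderOf_eq_one ρ
  have hcoeff : ∀ j ≤ m, ∀ α, (ρ ^ j) α * a j = a j * α := fun _ hj =>
    hinv.coeff_mul hfix ham hρm hj
  let f := SkewPoly.ofCoeffs ρ m a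
  let inj : (Subring.center (Residue f)).toAddSubgroup →+ (Residue.V f).toAddSubgroup :=
    AddSubgroup.inclusion (Subring.center_le_centralizer _)
  let I : (Residue.V f).toAddSubgroup →+ Residue.J f :=
    AddMonoidHom.mk' (fun h => ⟨Residue.innerX f h, Residue.innerX_mem_J h.2⟩)
      fun h k => Subtype.ext (Residue.innerX_add f h k)
  let τ : Residue.J f →+ (Residue.fixedV hfix).toAddSubgroup :=
    AddMonoidHom.mk' (fun h => ⟨Residue.tau hfix h, Residue.tau_mem_fixedV hfix hcoeff h.2⟩)
      fun h k => Subtype.ext (Residue.tau_add hfix h k)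
  have hI : ∀ h, (I h : Residue f) = Residue.innerX f h := fun _ => rfl
  have hτ : ∀ h, (τ h : Residue f) = Residue.tau hfix h := fun _ => rfl
  have hV : Residue.fixedV hfix ≤ Residue.V f := fun h hh => hh.1
  have hcenter := Residue.fixedV_le_center hfix
  have hcomm : ∀ s ∈ Residue.fixedV hfix, ∀ y, y * s = s * y := fun s hs =>
    Subring.mem_center_iff.1 (hcenter hs)
  have hJ : IsSubbimodule (Residue.fixedV hfix) (Residue.J f) := Residue.isSubbimodule_J f hV
  have hinjective : Function.Injective inj := AddSubgroup.inclusion_injective _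
  have hexactV : Function.Exact inj I := by
    intro h
    constructor
    · intro h0
      have h0' : Residue.innerX f h = 0 := congrArg Subtype.val h0
      exact ⟨⟨h, Residue.mem_center_of_commute (sub_eq_zero.1 h0') (Residue.mem_V.1 h.2)⟩, rfl⟩
    · rintro ⟨c, rfl⟩
      exact Subtype.ext (sub_eq_zero.2 (Subring.mem_center_iff.1 c.2 _).symm)
  have hweak : IsWeaklySeparableExtension (Residue.coe f) ↔ Function.Exact I τ := by
    rw [Residue.isWeaklySeparableExtension_iff hfix]
    constructor
    · intro hw h
      refine ⟨fun h0 => ?_, ?_⟩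
      · obtain ⟨c, hcV, hc⟩ := hw h h.2 (congrArg Subtype.val h0)
        exact ⟨⟨c, hcV⟩, Subtype.ext hc⟩
      · rintro ⟨c, rfl⟩
        exact Subtype.ext (Residue.tau_innerX hfix c.2)
    · intro hex h hh h0
      obtain ⟨c, hc⟩ := (hex ⟨h, hh⟩).1 (Subtype.ext h0)
      exact ⟨c, c.2, congrArg Subtype.val hc⟩
  have hsep : IsSeparableExtension (Residue.coe f) ↔ Function.Surjective τ := by
    constructor
    · intro hs v
      obtain ⟨h, hh, h1⟩ :=
        Residue.exists_tau_eq_one_of_isSeparable hfix hinv ham hm hρm hs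
      -- Linearity over `V^ρ̃` lets a preimage `h` of `1` produce the preimage `hv` of `v`.
      refine ⟨⟨h * v, (hJ v v.2 h hh).2⟩, Subtype.ext ?_⟩
      change Residue.tau hfix (h * v) = v
      rw [Residue.tau_mul hfix v.2, h1, one_mul]
    · intro hsurj
      obtain ⟨h, h1⟩ := hsurj ⟨1, (Residue.fixedV hfix).one_mem⟩
      exact Residue.isSeparable_of_tau_eq_one hfix hcoeff h.2 (congrArg Subtype.val h1)
  refine ⟨inj, I, τ, fun _ => rfl, hI, hτ, ?_, ?_, ?_, ?_, ?_⟩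
  · exact ⟨isSubbimodule_of_le hcenter, isSubbimodule_of_le hV, fun _ _ _ _ h => h,
      fun _ _ _ _ h => h⟩
  · refine ⟨isSubbimodule_of_le hV, hJ, fun s hs h k hk => ?_, fun s hs h k hk => ?_⟩
    · rw [hI, hI, hk]
      unfold Residue.innerX
      rw [mul_sub, mul_assoc, ← mul_assoc _ s, hcomm s hs, mul_assoc]
    · rw [hI, hI, hk]
      unfold Residue.innerX
      rw [sub_mul, mul_assoc, ← hcomm s hs, mul_assoc, mul_assoc]
  · refine ⟨hJ, isSubbimodule_of_le le_rfl, fun s hs h k hk => ?_, fun s hs h k hk => ?_⟩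
    · rw [hτ, hτ, hk, ← hcomm s hs, ← hcomm s hs, Residue.tau_mul hfix hs]
    · rw [hτ, hτ, hk, Residue.tau_mul hfix hs]
  · exact hweak.trans ⟨fun h => ⟨hinjective, hexactV, h⟩, fun h => h.2.2⟩
  -- Surjectivity of `τ` alone forces exactness at `J_ρ`, because separable extensions are weakly
  -- separable.
  · exact hsep.trans ⟨fun h => ⟨hinjective, hexactV,
      hweak.1 (hsep.2 h).isWeaklySeparableExtension, h⟩, fun h => h.2.2.2⟩
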